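/- Let $G$ be a group, $\{H_\lambda\}_{\lambda\in\Lambda}$ a family of subgroups of $G$, and for each $\lambda$ let $\{K_{\lambda,\mu}\}_{\mu\in M_\lambda}$ be a family of subgroups of $H_\lambda$ (no countability or finiteness is assumed of $G$, $\Lambda$, $M_\lambda$). Put $\mathcal H_\lambda=H_\lambda\setminus\{1\}$, $\mathcal H=\bigsqcup_\lambda\mathcal H_\lambda$, $\mathcal K_\lambda=\bigsqcup_{\mu}(K_{\lambda,\mu}\setminus\{1\})$, $\mathcal K=\bigsqcup_\lambda\mathcal K_\lambda$, regarded as sets of letters; words may also use the inverses of the letters of a generating set. Suppose that $\langle X, H_\lambda,\lambda\in\Lambda\mid R=1, R\in\mathcal R\rangle$ is a finite relative presentation of $G$ with respect to $\{H_\lambda\}$: $X\subset G$ is finite, $G$ is generated by $X\sqcup\mathcal H$, and $\mathcal R$ is a finite set of words over $X\sqcup\mathcal H$ whose normal closure in $F=F(X)*(\ast_\lambda H_\lambda)$ is the kernel of $F\to G$; moreover $\mathcal R$ is closed under inverses and cyclic shifts, and each $R\in\mathcal R$ has minimal length among the words representing the same element of $F$. Suppose that $G$ is hyperbolic relative to $\{H_\lambda\}$,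 i.e. that some finite relative presentation of $G$ with respect to $\{H_\lambda\}$ has a relative Dehn function that is bounded by a linear function $n\mapsto Bn$. Suppose also that $G$ is generated by $X\sqcup\mathcal K$. Let $\Omega_\lambda\subset\mathcal H_\lambda$ be the set of all elements represented by an $H_\lambda$-syllable (a maximal non-empty subword with letters in $\mathcal H_\lambda$) of some $R\in\mathcal R$, and $\Omega=\bigsqcup_\lambda\Omega_\lambda$. In the Cayley graph $\Gamma(G,X\sqcup\mathcal H)$ (a metric graph with edges of length $1$), an $H_\lambda$-component of a path is a subpath whose label is an $H_\lambda$-syllable of the label of the path. Two $H_\lambda$-components are connected if a (possibly trivial) path labelled by letters of $\mathcal H_\lambda$ joins a vertex of one to a vertex of the other. A path is locally minimal if, for all $\lambda$, its $H_\lambda$-components have length $1$, and without backtracking if, for all $\lambda$, no two distinct $H_\lambda$-components of it are connected. The same terms are used in $\Gamma(G,X\sqcup\Omega\sqcup\mathcal K)$ with the family $\{K_{\lambda,\mu}\}_{\lambda,\mu}$. A path is an $(\alpha,\beta)$-quasigeodesic if its arc length parametrisation $f$ satisfies $\frac1\alpha|s-t|-\beta\le d(f(s),f(t))\le\alpha|s-t|+\beta$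 for all $s,t$. A minimal lift of a locally minimal path $p$ without backtracking in $\Gamma(G,X\sqcup\mathcal H)$ is a path $\widehat p$ in $\Gamma(G,X\sqcup\Omega\sqcup\mathcal K)$ obtained by replacing, for every $\lambda$, each $H_\lambda$-component $r$ of $p$ with (a translate of) a geodesic of $\Gamma(H_\lambda,\Omega_\lambda\sqcup\mathcal K_\lambda)$ from $r_-$ to $r_+$. Then for all $\alpha\ge1$ and $\beta\ge0$ there exist constants $C\ge1$ and $D\ge0$ such that every locally minimal $(\alpha,\beta)$-quasigeodesic $p$ without backtracking in $\Gamma(G,X\sqcup\mathcal H)$ has a minimal lift, and every minimal lift $\widehat p$ of $p$ is a locally minimal $(C,D)$-quasigeodesic without backtracking in $\Gamma(G,X\sqcup\Omega\sqcup\mathcal K)$. -/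

import Mathlib

namespace RelHyp

/-! ### Words over `X ⊔ 𝓗` and relative presentations

A generating set is given by a map `a : S → G`, and a family of (peripheral) subgroups by
`H : ι → Subgroup G`. The index map `a` makes disjoint unions of generating sets literal. -/

/-- The letters of `S ⊔ 𝓗`: `gen x true` is the letter `x`, `gen x false` is its formal inverse
`x⁻¹`, and `per i h _` is the copy in `𝓗_i` of the element `h ∈ H_i ∖ {1}`. -/
inductive Letter {G ι : Type*} [Group G] (S : Type*) (H : ι → Subgroup G) where
  | gen (x : S) (ε : Bool) : Letter S H
  | per (i : ι) (h : H i) (hne : h ≠ 1) : Letter S H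

/-- The element of `G` represented by a letter. -/
def Letter.val {G ι S : Type*} [Group G] (a : S → G) {H : ι → Subgroup G} : Letter S H → G
  | .gen x true => a x
  | .gen x false => (a x)⁻¹
  | .per _ h _ => (h : G)

/-- The inverse letter. -/
def Letter.inv {G ι S : Type*} [Group G] {H : ι → Subgroup G} : Letter S H → Letter S H
  | .gen x ε => .gen x (!ε)
  | .per i h hne => .per i h⁻¹ (inv_ne_one.mpr hne)

/-- The letter belongs to `𝓗_i`. -/
def Letter.InFactor {G ι S : Type*} [Group G] {H : ι → Subgroup G} (i : ι) : Letter S H → Prop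
  | .gen _ _ => False
  | .per j _ _ => j = i

/-- The element of `G` represented by a word. -/
def wordVal {G ι S : Type*} [Group G] (a : S → G) {H : ι → Subgroup G}
    (W : List (Letter S H)) : G :=
  (W.map (Letter.val a)).prod

/-- The inverse word. -/
def wordInv {G ι S : Type*} [Group G] {H : ι → Subgroup G}
    (W : List (Letter S H)) : List (Letter S H) :=
  (W.map Letter.inv).reverse

/-- The free product `F = F(S) ∗ (∗_i H_i)`. -/
abbrev FreeProd {G ι : Type*} [Group G] (S : Type*) (H : ι → Subgroup G) : Type _ :=
  Monoid.Coprod (FreeGroup S) (Monoid.CoprodI fun i => H i)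

/-- The element of `F` represented by a letter. -/
def Letter.toFree {G ι S : Type*} [Group G] {H : ι → Subgroup G} : Letter S H → FreeProd S H
  | .gen x true => Monoid.Coprod.inl (FreeGroup.of x)
  | .gen x false => (Monoid.Coprod.inl (FreeGroup.of x))⁻¹
  | .per i h _ => Monoid.Coprod.inr (Monoid.CoprodI.of (i := i) h)

/-- The element of `F` represented by a word. -/
def wordFree {G ι S : Type*} [Group G] {H : ι → Subgroup G}
    (W : List (Letter S H)) : FreeProd S H :=
  (W.map Letter.toFree).prod

/-- The natural homomorphism `F → G`. -/
def freeProj {G ι S : Type*} [Group G] (a : S → G) (H : ι → Subgroup G) : FreeProd S H →* G :=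
  Monoid.Coprod.lift (FreeGroup.lift a) (Monoid.CoprodI.lift fun i => (H i).subtype)

/-- `G` is generated by (the image of) `a` relative to the family `H`. -/
def IsRelGenerating {G ι S : Type*} [Group G] (a : S → G) (H : ι → Subgroup G) : Prop :=
  Subgroup.closure (Set.range a ∪ ⋃ i, (H i : Set G)) = ⊤

/-- `⟨X, H_i | R = 1, R ∈ 𝓡⟩` is a finite, reduced relative presentation of `G` with respect to
the family `H`, with `𝓡` symmetric and closed under cyclic shifts. -/
structure IsFiniteRelPresentation {G ι : Type*} [Group G] (X : Set G) (H : ι → Subgroup G)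
    (𝓡 : Set (List (Letter X H))) : Prop where
  finite_gen : X.Finite
  finite_rel : 𝓡.Finite
  generates : IsRelGenerating (fun x : X => (x : G)) H
  kernel : Subgroup.normalClosure (wordFree '' 𝓡) = (freeProj (fun x : X => (x : G)) H).ker
  symmetric : ∀ R ∈ 𝓡, wordInv R ∈ 𝓡
  cyclic : ∀ R ∈ 𝓡, ∀ n : ℕ, R.rotate n ∈ 𝓡
  reduced : ∀ R ∈ 𝓡, ∀ W : List (Letter X H), wordFree W = wordFree R → R.length ≤ W.length

/-- The relative area of a word `W`: the least `n` such that `W = ∏_{k=1}^n f_k⁻¹ R_k f_k` in `F`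
with `f_k ∈ F` and `R_k ∈ 𝓡` (`⊤` if there is no such `n`). -/
noncomputable def relArea {G ι S : Type*} [Group G] {H : ι → Subgroup G}
    (𝓡 : Set (List (Letter S H))) (W : List (Letter S H)) : ℕ∞ :=
  ⨅ L : {L : List (FreeProd S H × List (Letter S H)) //
      (∀ c ∈ L, c.2 ∈ 𝓡) ∧ wordFree W = (L.map fun c => c.1⁻¹ * wordFree c.2 * c.1).prod},
    (L.1.length : ℕ∞)

/-- The relative Dehn function. -/
noncomputable def relDehn {G ι S : Type*} [Group G] (a : S → G) {H : ι → Subgroup G}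
    (𝓡 : Set (List (Letter S H))) (n : ℕ) : ℕ∞ :=
  ⨆ W : {W : List (Letter S H) // W.length ≤ n ∧ wordVal a W = 1}, relArea 𝓡 W.1

/-- `G` is hyperbolic relative to the family `H`: some finite relative presentation has a linear
relative Dehn function. -/
def IsRelHyperbolic {G ι : Type*} [Group G] (H : ι → Subgroup G) : Prop :=
  ∃ (X : Set G) (𝓡 : Set (List (Letter X H))), IsFiniteRelPresentation X H 𝓡 ∧
    ∃ B : ℕ, ∀ n : ℕ, relDehn (fun x : X => (x : G)) 𝓡 n ≤ ((B * n : ℕ) : ℕ∞)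

/-! ### Syllables and the set `Ω` -/

/-- The letters of `W` at the positions `i ≤ k < j` form an `H_l`-subword (non-trivial). -/
def IsSubword {G ι S : Type*} [Group G] {H : ι → Subgroup G} (W : List (Letter S H)) (l : ι)
    (i j : ℕ) : Prop :=
  i < j ∧ ∀ k, i ≤ k → k < j → ∃ u, W[k]? = some u ∧ u.InFactor l

/-- The letters of `W` at the positions `i ≤ k < j` form an `H_l`-syllable, that is, an
`H_l`-subword which is contained in no longer one. -/
def IsSyllable {G ι S : Type*} [Group G] {H : ι → Subgroup G} (W : List (Letter S H)) (l : ι)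
    (i j : ℕ) : Prop :=
  IsSubword W l i j ∧ ∀ i' j', i' ≤ i → j ≤ j' → IsSubword W l i' j' → i' = i ∧ j' = j

/-- `Ω_l`: the elements of `H_l ∖ {1}` that are represented by an `H_l`-syllable of some
`R ∈ 𝓡`. -/
def Om {G ι S : Type*} [Group G] (a : S → G) {H : ι → Subgroup G}
    (𝓡 : Set (List (Letter S H))) (l : ι) : Set G :=
  {g | g ∈ H l ∧ g ≠ 1 ∧ ∃ R ∈ 𝓡, ∃ i j, IsSyllable R l i j ∧
    wordVal a ((R.take j).drop i) = g}

/-! ### The Cayley graph `Γ(G, S ⊔ 𝓗)` and its paths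

An edge is a pair `(g, u)` of a vertex `g ∈ G` and a letter `u`; it goes from `g` to `g u`, and
its inverse edge is `(g u, u⁻¹)`. A path is thus a starting vertex with a word, its label. -/

/-- The terminus of an edge. -/
def edgeEnd {G ι S : Type*} [Group G] (a : S → G) {H : ι → Subgroup G} (e : G × Letter S H) : G :=
  e.1 * e.2.val a

/-- The inverse edge. -/
def edgeInv {G ι S : Type*} [Group G] (a : S → G) {H : ι → Subgroup G} (e : G × Letter S H) :
    G × Letter S H :=
  (edgeEnd a e, e.2.inv)

/-- A path in the Cayley graph. -/
structure CPath {G ι : Type*} [Group G] (S : Type*) (H : ι → Subgroup G) where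
  start : G
  word : List (Letter S H)

/-- The vertex of a path after `k` edges. -/
def CPath.vertex {G ι S : Type*} [Group G] (a : S → G) {H : ι → Subgroup G} (p : CPath S H)
    (k : ℕ) : G :=
  p.start * wordVal a (p.word.take k)

/-- The edge of a path that follows the `k`-th vertex (counted from `0`). -/
def CPath.edge {G ι S : Type*} [Group G] (a : S → G) {H : ι → Subgroup G} (p : CPath S H)
    (k : ℕ) (hk : k < p.word.length) : G × Letter S H :=
  (p.vertex a k, p.word[k])

/-- The distance of two vertices: the least length of a path between them. It is only used for
relative generating sets, where the graph is connected. -/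
noncomputable def vdist {G ι S : Type*} [Group G] (a : S → G) (H : ι → Subgroup G) (g h : G) : ℕ :=
  sInf {n | ∃ W : List (Letter S H), W.length = n ∧ g * wordVal a W = h}

open Classical in
/-- The distance in the metric graph, all of whose edges have length `1`, of the point of the edge
`e` at distance `s ∈ [0, 1]` from its origin and the point of the edge `f` at distance `t ∈ [0, 1]`
from its origin: one goes through end points of `e` and `f`, or inside the edge if `f = e` or
`f = e⁻¹`. -/
noncomputable def pointDist {G ι S : Type*} [Group G] (a : S → G) {H : ι → Subgroup G}
    (e : G × Letter S H) (s : ℝ) (f : G × Letter S H) (t : ℝ) : ℝ :=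
  let outer : ℝ := min
    (min (s + vdist a H e.1 f.1 + t) (s + vdist a H e.1 (edgeEnd a f) + (1 - t)))
    (min ((1 - s) + vdist a H (edgeEnd a e) f.1 + t)
      ((1 - s) + vdist a H (edgeEnd a e) (edgeEnd a f) + (1 - t)))
  if f = e then min |s - t| outer
  else if f = edgeInv a e then min |s - (1 - t)| outer
  else outer

/-- The path, parametrised by arc length on `[0, l(p)]`, is an `(α, β)`-quasi-isometric embedding
into the metric graph; the parameter `i + s` with `s ∈ [0, 1]` is the point of the `i`-th edge at
distance `s` from its origin. -/
def CPath.IsQuasigeodesic {G ι S : Type*} [Group G] (a : S → G) {H : ι → Subgroup G} (α β : ℝ)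
    (p : CPath S H) : Prop :=
  ∀ (i j : ℕ) (hi : i < p.word.length) (hj : j < p.word.length),
    ∀ s ∈ Set.Icc (0 : ℝ) 1, ∀ t ∈ Set.Icc (0 : ℝ) 1,
      1 / α * |((i : ℝ) + s) - ((j : ℝ) + t)| - β ≤ pointDist a (p.edge a i hi) s (p.edge a j hj) t ∧
      pointDist a (p.edge a i hi) s (p.edge a j hj) t ≤ α * |((i : ℝ) + s) - ((j : ℝ) + t)| + β

/-- Every `𝓗`-component has length `1`. (The subpath between the vertices number `i` and `j` is
an `H_l`-component if the corresponding subword of the label is an `H_l`-syllable.) -/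
def CPath.IsLocallyMinimal {G ι S : Type*} [Group G] {H : ι → Subgroup G} (p : CPath S H) : Prop :=
  ∀ l i j, IsSyllable p.word l i j → j - i = 1

/-- The subpaths between the vertices number `i`, `j` and number `i'`, `j'` are connected: some
path labelled by letters of `𝓗_l` (possibly trivial) joins a vertex of the first one to a vertex of
the second one. -/
def CPath.Connected {G ι S : Type*} [Group G] (a : S → G) {H : ι → Subgroup G} (p : CPath S H)
    (l : ι) (i j i' j' : ℕ) : Prop :=
  ∃ k k', i ≤ k ∧ k ≤ j ∧ i' ≤ k' ∧ k' ≤ j' ∧ ∃ c : List (Letter S H),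
    (∀ u ∈ c, u.InFactor l) ∧ p.vertex a k * wordVal a c = p.vertex a k'

/-- Every `𝓗`-component is isolated: no `H_l`-component is connected to another
`H_l`-component. -/
def CPath.WithoutBacktracking {G ι S : Type*} [Group G] (a : S → G) {H : ι → Subgroup G}
    (p : CPath S H) : Prop :=
  ∀ l i j i' j', IsSyllable p.word l i j → IsSyllable p.word l i' j' → (i, j) ≠ (i', j') →
    ¬ p.Connected a l i j i' j'

/-! ### Minimal lifts -/

/-- The generating set `X ⊔ Ω` with `Ω = ⨆_l Ω_l`, as a disjoint union. -/
abbrev GenOm {G Λ : Type*} [Group G] (X : Set G) {H : Λ → Subgroup G}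
    (𝓡 : Set (List (Letter X H))) : Type _ :=
  X ⊕ (Σ l : Λ, Om (fun x : X => (x : G)) 𝓡 l)

/-- The elements of `G` given by `X ⊔ Ω`. -/
def genOmVal {G Λ : Type*} [Group G] (X : Set G) {H : Λ → Subgroup G}
    (𝓡 : Set (List (Letter X H))) : GenOm X 𝓡 → G
  | .inl x => (x : G)
  | .inr w => (w.2 : G)

/-- The family of all `K_{l,m}`. -/
abbrev famK {G Λ : Type*} [Group G] {M : Λ → Type*} (K : ∀ l, M l → Subgroup G) :
    (Σ l, M l) → Subgroup G :=
  fun lm => K lm.1 lm.2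

/-- The letter of `X ⊔ Ω ⊔ 𝓚` belongs to `Ω_l ⊔ 𝓚_l`. -/
def OverLocal {G Λ : Type*} [Group G] {X : Set G} {H : Λ → Subgroup G}
    {𝓡 : Set (List (Letter X H))} {M : Λ → Type*} {K : ∀ l, M l → Subgroup G} (l : Λ) :
    Letter (GenOm X 𝓡) (famK K) → Prop
  | .gen (.inl _) _ => False
  | .gen (.inr w) _ => w.1 = l
  | .per lm _ _ => lm.1 = l

/-- `V` is the label of a geodesic from `1` to `h` in `Γ(H_l, Ω_l ⊔ 𝓚_l)`, whose paths are the
words over `Ω_l ⊔ 𝓚_l`. -/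
def IsLocalGeodesic {G Λ : Type*} [Group G] {X : Set G} {H : Λ → Subgroup G}
    (𝓡 : Set (List (Letter X H))) {M : Λ → Type*} (K : ∀ l, M l → Subgroup G) (l : Λ) (h : G)
    (V : List (Letter (GenOm X 𝓡) (famK K))) : Prop :=
  ((∀ u ∈ V, OverLocal l u) ∧ wordVal (genOmVal X 𝓡) V = h) ∧
    ∀ V' : List (Letter (GenOm X 𝓡) (famK K)), (∀ u ∈ V', OverLocal l u) →
      wordVal (genOmVal X 𝓡) V' = h → V.length ≤ V'.length

/-- An edge labelled by `X` is kept, and an edge labelled by `h ∈ 𝓗_l` is replaced with (a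
translate of) a geodesic in `Γ(H_l, Ω_l ⊔ 𝓚_l)`. -/
def IsEdgeLift {G Λ : Type*} [Group G] {X : Set G} {H : Λ → Subgroup G}
    (𝓡 : Set (List (Letter X H))) {M : Λ → Type*} (K : ∀ l, M l → Subgroup G) :
    Letter X H → List (Letter (GenOm X 𝓡) (famK K)) → Prop
  | .gen x ε, V => V = [.gen (.inl x) ε]
  | .per l h _, V => IsLocalGeodesic 𝓡 K l h V

/-- `q` is a minimal lift of the locally minimal path `p` (the `𝓗`-components of such a path are
exactly its edges labelled by letters of `𝓗`). -/
def IsMinimalLift {G Λ : Type*} [Group G] {X : Set G} {H : Λ → Subgroup G}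
    (𝓡 : Set (List (Letter X H))) {M : Λ → Type*} (K : ∀ l, M l → Subgroup G)
    (p : CPath X H) (q : CPath (GenOm X 𝓡) (famK K)) : Prop :=
  q.start = p.start ∧ ∃ Vs : List (List (Letter (GenOm X 𝓡) (famK K))),
    List.Forall₂ (IsEdgeLift 𝓡 K) p.word Vs ∧ q.word = Vs.flatten

end RelHyp

/-! The proof bounds the length of a lift by integrating a function along loops. Given functions `φ
l : G → ℤ`, let the variation of a path in Γ(G, X ⊔ 𝓗) be the sum, over its edges labelled in 𝓗_l,
of the increments of `φ l`; edges labelled by X count 0. It depends only on the origin and on the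
element of F = F(X) * (∗ H_l) represented by the label (`variationHom`). Around a relator R it
splits into one increment per syllable. So if each `φ l` varies by at most c along Ω_l, it is at
most c|R| (`abs_variation_drop_le`). Hyperbolicity turns this into a bound A c |W| for every loop W,
with A independent of φ and c (`exists_linear_loopBound`). Only bounds on variation are transferred
from the presentation with linear Dehn function to the given one.

Two choices of φ suffice. With c = 0, the indicator function of the subgroup generated by Ω_l ⊔ 𝓚_l
shows that this subgroup is all of H_l (`exists_local_word`), so lifts exist. With c = 1, `edgeDist`
measures, on the coset of each 𝓗-edge of p, the Ω ⊔ 𝓚-distance to the origin of that edge. It is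
well defined because a locally minimal path without backtracking meets each coset of H_l in at most
one 𝓗_l-edge. Its variation along p is the total length of the lifted 𝓗-edges.

To compare two vertices of the lift, close up the subpath of p between the edges below them with a
shortest path U in Γ(G, X ⊔ Ω ⊔ 𝓚), read in Γ(G, X ⊔ 𝓗). The variation along U is at most |U|, and
the loop bound controls the rest. The length of the lift is thus linear in |U| and the length of the
subpath of p, which is itself linear in |U| as p is a quasigeodesic (`IsMinimalLift.sub_le`).
Absence of backtracking is inherited separately: a repeated coset of K_{l,m} would give a repeated
coset of H_l or a shortcut in a geodesic. -/

namespace RelHyp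

/-! ### Words, the elements they represent, and distances of vertices -/

section Words

variable {G ι S : Type*} [Group G] (a : S → G) {H : ι → Subgroup G}

@[simp] lemma wordVal_nil : wordVal a ([] : List (Letter S H)) = 1 := rfl

@[simp] lemma wordVal_cons (u : Letter S H) (W : List (Letter S H)) :
    wordVal a (u :: W) = u.val a * wordVal a W := by simp [wordVal]

@[simp] lemma wordVal_append (U W : List (Letter S H)) :
    wordVal a (U ++ W) = wordVal a U * wordVal a W := by simp [wordVal]

@[simp] lemma Letter.val_inv (u : Letter S H) : u.inv.val a = (u.val a)⁻¹ := by
  rcases u with ⟨x, _ | _⟩ | ⟨i, h, hne⟩ <;> simp [Letter.inv, Letter.val]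

@[simp] lemma wordVal_wordInv (W : List (Letter S H)) :
    wordVal a (wordInv W) = (wordVal a W)⁻¹ := by
  induction W with
  | nil => simp [wordInv]
  | cons u W ih =>
    have : wordInv (u :: W) = wordInv W ++ [u.inv] := by simp [wordInv]
    rw [this, wordVal_append, ih]
    simp

@[simp] lemma length_wordInv (W : List (Letter S H)) : (wordInv W).length = W.length := by
  simp [wordInv]

@[simp] lemma wordFree_nil : wordFree ([] : List (Letter S H)) = 1 := rfl

@[simp] lemma wordFree_cons (u : Letter S H) (W : List (Letter S H)) :
    wordFree (u :: W) = u.toFree * wordFree W := by simp [wordFree]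

@[simp] lemma wordFree_append (U W : List (Letter S H)) :
    wordFree (U ++ W) = wordFree U * wordFree W := by simp [wordFree]

@[simp] lemma Letter.toFree_inv (u : Letter S H) : u.inv.toFree = u.toFree⁻¹ := by
  rcases u with ⟨x, _ | _⟩ | ⟨i, h, hne⟩ <;> simp [Letter.inv, Letter.toFree]

@[simp] lemma wordFree_wordInv (W : List (Letter S H)) :
    wordFree (wordInv W) = (wordFree W)⁻¹ := by
  induction W with
  | nil => simp [wordInv]
  | cons u W ih =>
    have : wordInv (u :: W) = wordInv W ++ [u.inv] := by simp [wordInv]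
    rw [this, wordFree_append, ih]
    simp

@[simp] lemma freeProj_toFree (u : Letter S H) : freeProj a H u.toFree = u.val a := by
  rcases u with ⟨x, _ | _⟩ | ⟨i, h, hne⟩ <;> simp [freeProj, Letter.val, Letter.toFree]

@[simp] lemma freeProj_wordFree (W : List (Letter S H)) :
    freeProj a H (wordFree W) = wordVal a W := by
  induction W with
  | nil => simp
  | cons u W ih => simp [ih]

lemma exists_wordVal_eq {a : S → G} (hgen : IsRelGenerating a H) (g : G) :
    ∃ W : List (Letter S H), wordVal a W = g := by
  have hg : g ∈ Subgroup.closure (Set.range a ∪ ⋃ i, (H i : Set G)) := by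
    rw [hgen]; trivial
  induction hg using Subgroup.closure_induction with
  | mem x hx =>
    rcases hx with ⟨s, rfl⟩ | hx
    · exact ⟨[.gen s true], by simp [Letter.val]⟩
    · obtain ⟨i, hi⟩ := Set.mem_iUnion.mp hx
      by_cases h1 : x = 1
      · exact ⟨[], by simp [h1]⟩
      · exact ⟨[.per i ⟨x, hi⟩ (by simpa [Subtype.ext_iff] using h1)], by simp [Letter.val]⟩
  | one => exact ⟨[], rfl⟩
  | mul x y _ _ hx hy =>
    obtain ⟨U, rfl⟩ := hx
    obtain ⟨W, rfl⟩ := hy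
    exact ⟨U ++ W, by simp⟩
  | inv x _ hx =>
    obtain ⟨U, rfl⟩ := hx
    exact ⟨wordInv U, by simp⟩

/-- A word of length at most one for an element of a factor. -/
lemma exists_short_word (i : ι) (h : H i) :
    ∃ W : List (Letter S H), W.length ≤ 1 ∧ (∀ u ∈ W, u.InFactor i) ∧
      wordFree W = (Monoid.Coprod.inr (Monoid.CoprodI.of h) : FreeProd S H) := by
  by_cases h1 : h = 1
  · exact ⟨[], by simp, by simp, by simp [h1]⟩
  · exact ⟨[.per i h h1], by simp, by simp [Letter.InFactor], by simp [Letter.toFree]⟩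

lemma Letter.InFactor.val_mem {i : ι} {u : Letter S H} (hu : u.InFactor i) : u.val a ∈ H i := by
  rcases u with ⟨x, _ | _⟩ | ⟨j, h, hne⟩
  · exact hu.elim
  · exact hu.elim
  · obtain rfl : j = i := hu
    exact h.2

lemma wordVal_mem {i : ι} {W : List (Letter S H)} (hW : ∀ u ∈ W, u.InFactor i) :
    wordVal a W ∈ H i := by
  induction W with
  | nil => exact one_mem _
  | cons u W ih =>
    rw [wordVal_cons]
    exact mul_mem (hW u (by simp) |>.val_mem a) (ih fun v hv => hW v (by simp [hv]))

/-! ### The distance of vertices -/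

lemma vdist_le {g h : G} (W : List (Letter S H)) (hW : g * wordVal a W = h) :
    vdist a H g h ≤ W.length :=
  Nat.sInf_le ⟨W, rfl, hW⟩

variable {a}

lemma exists_word_vdist (hgen : IsRelGenerating a H) (g h : G) :
    ∃ W : List (Letter S H), W.length = vdist a H g h ∧ g * wordVal a W = h := by
  obtain ⟨W, hW⟩ := exists_wordVal_eq hgen (g⁻¹ * h)
  exact Nat.sInf_mem (s := {n | ∃ W : List (Letter S H), W.length = n ∧ g * wordVal a W = h})
    ⟨_, W, rfl, by rw [hW]; group⟩

lemma vdist_triangle (hgen : IsRelGenerating a H) (g h k : G) :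
    vdist a H g k ≤ vdist a H g h + vdist a H h k := by
  obtain ⟨U, hU, rfl⟩ := exists_word_vdist hgen g h
  obtain ⟨W, hW, rfl⟩ := exists_word_vdist hgen (g * wordVal a U) k
  rw [← hU, ← hW, ← List.length_append]
  exact vdist_le a _ (by simp [mul_assoc])

lemma vdist_comm (hgen : IsRelGenerating a H) (g h : G) : vdist a H g h = vdist a H h g := by
  have key : ∀ g h : G, vdist a H h g ≤ vdist a H g h := fun g h => by
    obtain ⟨U, hU, rfl⟩ := exists_word_vdist hgen g h
    rw [← hU, ← length_wordInv]
    exact vdist_le a _ (by simp)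
  exact le_antisymm (key h g) (key g h)

end Words

/-! ### The cocycle of a family of functions on the group -/

section Cocycle

variable {G ι S : Type*} [Group G]

/-- The right regular action on functions. -/
def shiftAut (G : Type*) [Group G] : G →* MulAut (G → Multiplicative ℤ) where
  toFun g :=
    { toFun := fun n y => n (y * g)
      invFun := fun n y => n (y * g⁻¹)
      left_inv := fun n => by ext y; simp
      right_inv := fun n => by ext y; simp
      map_mul' := fun _ _ => rfl }
  map_one' := by ext n y; simp
  map_mul' g h := by ext n y; simp [mul_assoc]

lemma shiftAut_apply (g : G) (n : G → Multiplicative ℤ) (y : G) :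
    shiftAut G g n y = n (y * g) := rfl

/-- The homomorphism that records, for an element of the free product, its value in `G` and
the total variation of `φ i` along the letters of `H i` of a path. -/
def variationHom (a : S → G) (H : ι → Subgroup G) (φ : ι → G → ℤ) :
    FreeProd S H →* (G → Multiplicative ℤ) ⋊[shiftAut G] G :=
  Monoid.Coprod.lift (FreeGroup.lift fun x => SemidirectProduct.inr (a x))
    (Monoid.CoprodI.lift fun i =>
      -- The increment of `φ i` is a coboundary, so it telescopes over products in H i; this is what
      -- makes the map multiplicative.
      { toFun := fun h => ⟨fun y => Multiplicative.ofAdd (φ i (y * h) - φ i y), h⟩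
        map_one' := by
          ext <;> simp
        map_mul' := fun h k => by
          ext
          · simp [shiftAut_apply, mul_assoc]
          · simp })

/-- The variation of `φ` along a path that starts at `g` and represents `f`. -/
def variation (a : S → G) {H : ι → Subgroup G} (φ : ι → G → ℤ) (g : G) (f : FreeProd S H) : ℤ :=
  Multiplicative.toAdd ((variationHom a H φ f).left g)

variable (a : S → G) {H : ι → Subgroup G} (φ : ι → G → ℤ)

lemma variationHom_right (f : FreeProd S H) : (variationHom a H φ f).right = freeProj a H f := by
  have : (SemidirectProduct.rightHom).comp (variationHom a H φ) = freeProj a H := by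
    apply Monoid.Coprod.hom_ext
    · ext x; simp [variationHom, freeProj]
    · ext i x; simp [variationHom, freeProj]
  exact DFunLike.congr_fun this f

@[simp] lemma variation_one (g : G) : variation a φ g (1 : FreeProd S H) = 0 := by
  simp [variation]

lemma variation_mul (g : G) (f f' : FreeProd S H) :
    variation a φ g (f * f') = variation a φ g f + variation a φ (g * freeProj a H f) f' := by
  simp [variation, shiftAut_apply, variationHom_right]

lemma variation_inv (g : G) (f : FreeProd S H) :
    variation a φ g f⁻¹ = - variation a φ (g * (freeProj a H f)⁻¹) f := by
  have := variation_mul a φ g f⁻¹ f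
  simp only [inv_mul_cancel, variation_one, map_inv] at this
  linarith

@[simp] lemma variation_gen (g : G) (x : S) (ε : Bool) :
    variation a φ g (Letter.gen (H := H) x ε).toFree = 0 := by
  cases ε
  · simp only [Letter.toFree, variation_inv]
    simp [variation, variationHom]
  · simp [Letter.toFree, variation, variationHom]

@[simp] lemma variation_inr_of (g : G) (i : ι) (h : H i) :
    variation a φ g (Monoid.Coprod.inr (Monoid.CoprodI.of h) : FreeProd S H)
      = φ i (g * h) - φ i g := by
  simp [variation, variationHom]

lemma variation_eq_of_inFactor (g : G) {i : ι} {u : Letter S H} (hu : u.InFactor i) :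
    variation a φ g u.toFree = φ i (g * u.val a) - φ i g := by
  rcases u with ⟨x, ε⟩ | ⟨j, h, hne⟩
  · exact hu.elim
  · obtain rfl : j = i := hu
    exact variation_inr_of a φ g j h

lemma variation_word_eq_of_inFactor (g : G) {i : ι} {W : List (Letter S H)}
    (hW : ∀ u ∈ W, u.InFactor i) :
    variation a φ g (wordFree W) = φ i (g * wordVal a W) - φ i g := by
  induction W generalizing g with
  | nil => simp
  | cons u W ih =>
    rw [wordFree_cons, variation_mul, ih _ fun v hv => hW v (by simp [hv]),
      variation_eq_of_inFactor a φ g (hW u (by simp))]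
    simp [mul_assoc]

end Cocycle

/-! ### Syllables -/

section Syllables

variable {G ι S : Type*} [Group G] {H : ι → Subgroup G}

lemma IsSubword.le_length {W : List (Letter S H)} {l : ι} {i j : ℕ} (h : IsSubword W l i j) :
    j ≤ W.length := by
  obtain ⟨hij, h⟩ := h
  obtain ⟨u, hu, _⟩ := h (j - 1) (by omega) (by omega)
  have := (List.getElem?_eq_some_iff.mp hu).1
  omega

lemma IsSubword.mono {W : List (Letter S H)} {l : ι} {i j i' j' : ℕ} (h : IsSubword W l i j)
    (hi : i ≤ i') (hj : j' ≤ j) (hij : i' < j') : IsSubword W l i' j' :=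
  ⟨hij, fun k hk hk' => h.2 k (by omega) (by omega)⟩

lemma IsSubword.exists_isSyllable {W : List (Letter S H)} {l : ι} {i j : ℕ}
    (h : IsSubword W l i j) : ∃ i' j', i' ≤ i ∧ j ≤ j' ∧ IsSyllable W l i' j' := by
  by_contra hcon
  push Not at hcon
  -- If no enlargement were maximal, one could enlarge forever, past the length of W.
  have key : ∀ n : ℕ, ∃ i' j', i' ≤ i ∧ j ≤ j' ∧ IsSubword W l i' j' ∧ n ≤ j' - i' := by
    intro n
    induction n with
    | zero => exact ⟨i, j, le_rfl, le_rfl, h, Nat.zero_le _⟩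
    | succ n ih =>
      obtain ⟨i', j', hi, hj, hs, hn⟩ := ih
      have hns := hcon i' j' hi hj
      simp only [IsSyllable, not_and, not_forall] at hns
      obtain ⟨i'', j'', hi', hj', hs', hne⟩ := hns hs
      refine ⟨i'', j'', by omega, by omega, hs', ?_⟩
      have := hs.1
      by_contra hlt
      exact hne (by omega) (by omega)
  obtain ⟨i', j', -, -, hs, hn⟩ := key (W.length + 1)
  have := hs.le_length
  omega

lemma wordVal_drop_take (a : S → G) (W : List (Letter S H)) {i j : ℕ} (hij : i ≤ j) :
    wordVal a (W.take j) = wordVal a (W.take i) * wordVal a ((W.take j).drop i) := by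
  rw [← wordVal_append]
  congr 1
  conv_lhs => rw [← List.take_append_drop i (W.take j)]
  rw [List.take_take, min_eq_left hij]

/-! ### Variation around relators and around arbitrary loops -/

variable (a : S → G) {φ : ι → G → ℤ} {c : ℤ}

/-- `φ l` varies by at most `c` along the edges labelled by `Om a 𝓡 l`. -/
def OmLipschitz (𝓡 : Set (List (Letter S H))) (φ : ι → G → ℤ) (c : ℤ) : Prop :=
  0 ≤ c ∧ ∀ l g w, w ∈ Om a 𝓡 l → |φ l (g * w) - φ l g| ≤ c

variable {a} {𝓡 : Set (List (Letter S H))}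

/-- Each syllable telescopes to a single increment, of size at most c, and there are no more
syllables than letters. The induction peels off one generator or one whole syllable at a time; the
last hypothesis says that no subword from a single factor straddles position `i`. -/
lemma abs_variation_drop_le (hφ : OmLipschitz a 𝓡 φ c) {R : List (Letter S H)} (hR : R ∈ 𝓡)
    (n : ℕ) : ∀ (i : ℕ) (g : G), R.length - i = n →
      (∀ l i' j', IsSubword R l i' j' → i' < i → j' ≤ i) →
      |variation a φ g (wordFree (R.drop i))| ≤ c * n := by
  induction n using Nat.strong_induction_on with
  | _ n ih =>
  intro i g hn hb
  rcases Nat.lt_or_ge i R.length with hi | hi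
  swap
  · have := hφ.1
    rw [List.drop_eq_nil_of_le hi]
    simpa using by positivity
  rcases hu : R[i] with ⟨x, ε⟩ | ⟨l, h, hne⟩
  · rw [List.drop_eq_getElem_cons hi, hu, wordFree_cons, variation_mul, variation_gen, zero_add]
    refine (ih (n - 1) (by omega) (i + 1) _ (by omega) ?_).trans ?_
    · intro l i' j' hs hlt
      by_contra hlt'
      obtain ⟨u, hu1, hu2⟩ := hs.2 i (by omega) (by omega)
      rw [List.getElem?_eq_getElem hi, hu] at hu1
      obtain rfl := Option.some.inj hu1
      exact hu2
    · exact mul_le_mul_of_nonneg_left (by omega) hφ.1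
  · have hsub : IsSubword R l i (i + 1) := by
      refine ⟨by omega, fun k hk hk' => ?_⟩
      obtain rfl : k = i := by omega
      exact ⟨_, List.getElem?_eq_getElem hi, by rw [hu]; rfl⟩
    obtain ⟨i', j, hi', hj, hsyl⟩ := hsub.exists_isSyllable
    obtain rfl : i' = i := by
      by_contra hne
      have := hb l i' j hsyl.1 (by omega)
      omega
    have hjl := hsyl.1.le_length
    have hsplit : R.drop i' = (R.take j).drop i' ++ R.drop j := by
      conv_lhs => rw [← List.take_append_drop j R]
      rw [List.drop_append_of_le_length (by simp; omega)]
    have hfac : ∀ u ∈ (R.take j).drop i', u.InFactor l := by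
      intro u hu'
      obtain ⟨k, hk, rfl⟩ := List.mem_iff_getElem.mp hu'
      simp only [List.length_drop, List.length_take] at hk
      obtain ⟨u, hu1, hu2⟩ := hsyl.1.2 (i' + k) (by omega) (by omega)
      obtain ⟨hlt, rfl⟩ := List.getElem?_eq_some_iff.mp hu1
      simpa using hu2
    rw [hsplit, wordFree_append, variation_mul, variation_word_eq_of_inFactor a φ g hfac]
    have h1 : |φ l (g * wordVal a ((R.take j).drop i')) - φ l g| ≤ c := by
      -- A syllable representing 1 gives no element of `Om`, but its increment is 0.
      by_cases hone : wordVal a ((R.take j).drop i') = 1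
      · rw [hone]; simpa using hφ.1
      · exact hφ.2 l g _ ⟨wordVal_mem a hfac, hone, R, hR, i', j, hsyl, rfl⟩
    have h2 := ih (n - (j - i')) (by omega) j
      (g * freeProj a H (wordFree ((R.take j).drop i'))) (by omega) (by
        -- A subword straddling `j` would put the letters before and after `j` in one factor, and so
        -- would prolong the maximal syllable that ends there.
        intro l' i'' j'' hs hlt
        by_contra hlt'
        have hmid : IsSubword R l' (j - 1) (j + 1) :=
          hs.mono (by omega) (by omega) (by omega)
        obtain ⟨u, hu1, hu2⟩ := hmid.2 (j - 1) (by omega) (by omega)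
        obtain ⟨v, hv1, hv2⟩ := hsyl.1.2 (j - 1) (by omega) (by omega)
        obtain rfl := Option.some.inj (hu1.symm.trans hv1)
        obtain rfl : l' = l := by
          rcases u with ⟨x, ε⟩ | ⟨m, h, hne⟩
          · exact hu2.elim
          · exact Eq.trans (Eq.symm hu2) hv2
        have hlong : IsSubword R l' i' (j + 1) := by
          refine ⟨by omega, fun k hk hk' => ?_⟩
          rcases Nat.lt_or_ge k j with hkj | hkj
          · exact hsyl.1.2 k hk hkj
          · exact hmid.2 k (by omega) hk'
        have := (hsyl.2 i' (j + 1) le_rfl (by omega) hlong).2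
        omega)
    have hle : ((n - (j - i') : ℕ) : ℤ) + 1 ≤ n := by omega
    have := mul_le_mul_of_nonneg_left hle hφ.1
    calc _ ≤ _ := abs_add_le _ _
      _ ≤ c + c * ((n - (j - i') : ℕ) : ℤ) := add_le_add h1 h2
      _ ≤ c * n := by linarith

/-- The variation of every function along every loop representing `f` is bounded by `n` times its
Lipschitz constant on the syllables of relators. -/
def LoopBound (a : S → G) (𝓡 : Set (List (Letter S H))) (f : FreeProd S H) (n : ℕ) : Prop :=
  freeProj a H f = 1 ∧ ∀ (φ : ι → G → ℤ) (c : ℤ), OmLipschitz a 𝓡 φ c →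
    ∀ g, |variation a φ g f| ≤ c * n

lemma LoopBound.one : LoopBound a 𝓡 1 0 :=
  ⟨map_one _, fun φ c hφ g => by simp⟩

lemma LoopBound.mono {f : FreeProd S H} {n m : ℕ} (h : LoopBound a 𝓡 f n) (hnm : n ≤ m) :
    LoopBound a 𝓡 f m :=
  ⟨h.1, fun φ c hφ g => (h.2 φ c hφ g).trans
    (mul_le_mul_of_nonneg_left (by exact_mod_cast hnm) hφ.1)⟩

lemma LoopBound.mul {f f' : FreeProd S H} {n m : ℕ} (h : LoopBound a 𝓡 f n)
    (h' : LoopBound a 𝓡 f' m) : LoopBound a 𝓡 (f * f') (n + m) := by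
  refine ⟨by rw [map_mul, h.1, h'.1, one_mul], fun φ c hφ g => ?_⟩
  rw [variation_mul]
  refine (abs_add_le _ _).trans ?_
  push_cast
  rw [mul_add]
  exact add_le_add (h.2 φ c hφ _) (h'.2 φ c hφ _)

lemma LoopBound.inv {f : FreeProd S H} {n : ℕ} (h : LoopBound a 𝓡 f n) :
    LoopBound a 𝓡 f⁻¹ n := by
  refine ⟨by rw [map_inv, h.1, inv_one], fun φ c hφ g => ?_⟩
  rw [variation_inv, abs_neg]
  exact h.2 φ c hφ _

/-- As f is a loop, d and d⁻¹ are traversed between the same vertices and cancel; only the base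
point of f moves. -/
lemma LoopBound.conj {f : FreeProd S H} {n : ℕ} (h : LoopBound a 𝓡 f n) (d : FreeProd S H) :
    LoopBound a 𝓡 (d * f * d⁻¹) n := by
  refine ⟨by simp [h.1], fun φ c hφ g => ?_⟩
  rw [variation_mul, variation_mul, variation_inv]
  simp only [map_mul, h.1, mul_one, mul_inv_cancel_right]
  convert h.2 φ c hφ (g * freeProj a H d) using 2
  ring

lemma LoopBound.list_prod {α : Type*} {n : ℕ} (F : α → FreeProd S H) (L : List α)
    (h : ∀ x ∈ L, LoopBound a 𝓡 (F x) n) :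
    LoopBound a 𝓡 (L.map F).prod (n * L.length) := by
  induction L with
  | nil => simpa using LoopBound.one
  | cons x L ih =>
    rw [List.map_cons, List.prod_cons, List.length_cons, mul_add, mul_one, add_comm]
    exact (h x (by simp)).mul (ih fun y hy => h y (by simp [hy]))

/-- Elements admitting some bound form a normal subgroup, and it contains every relator, with its
length as bound. -/
lemma exists_loopBound (hker : Subgroup.normalClosure (wordFree '' 𝓡) = (freeProj a H).ker)
    {f : FreeProd S H} (hf : freeProj a H f = 1) : ∃ n, LoopBound a 𝓡 f n := by
  let N : Subgroup (FreeProd S H) :=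
    { carrier := {f | ∃ n, LoopBound a 𝓡 f n}
      one_mem' := ⟨0, LoopBound.one⟩
      mul_mem' := fun ⟨n, hn⟩ ⟨m, hm⟩ => ⟨n + m, hn.mul hm⟩
      inv_mem' := fun ⟨n, hn⟩ => ⟨n, hn.inv⟩ }
  have : N.Normal := ⟨fun f ⟨n, hn⟩ d => ⟨n, hn.conj d⟩⟩
  have hle : Subgroup.normalClosure (wordFree '' 𝓡) ≤ N := by
    refine Subgroup.normalClosure_le_normal ?_
    rintro _ ⟨R, hR, rfl⟩
    refine ⟨R.length, ?_, fun φ c hφ g => ?_⟩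
    · have : wordFree R ∈ (freeProj a H).ker := by
        rw [← hker]; exact Subgroup.subset_normalClosure ⟨R, hR, rfl⟩
      exact this
    · simpa using abs_variation_drop_le hφ hR R.length 0 g (by simp) (by simp)
  exact hle (by rw [hker]; exact hf)

end Syllables

/-! ### Comparing two presentations -/

section Transfer

variable {G ι S S' : Type*} [Group G] {H : ι → Subgroup G}

/-- The homomorphism of free products that is given on the free factor and is the identity on the
peripheral ones. -/
def substHom (s : S → FreeProd S' H) : FreeProd S H →* FreeProd S' H :=
  Monoid.Coprod.lift (FreeGroup.lift s) Monoid.Coprod.inr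

lemma freeProj_substHom {a : S → G} {a' : S' → G} {s : S → FreeProd S' H}
    (hs : ∀ x, freeProj a' H (s x) = a x) (f : FreeProd S H) :
    freeProj a' H (substHom s f) = freeProj a H f := by
  have : (freeProj a' H).comp (substHom s) = freeProj a H := by
    apply Monoid.Coprod.hom_ext
    · ext x; simp [substHom, freeProj, ← hs]
    · ext i x; simp [substHom, freeProj]
  exact DFunLike.congr_fun this f

@[simp] lemma substHom_per (s : S → FreeProd S' H) (i : ι) (h : H i) (hne : h ≠ 1) :
    substHom s (Letter.per i h hne).toFree = (Letter.per i h hne).toFree := by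
  simp [substHom, Letter.toFree]

/-- Peripheral letters are kept, whence the requirement `1 ≤ k`: the length grows at most by the
factor `k`. -/
lemma exists_substHom_word (t : S → List (Letter S' H)) {k : ℕ} (hk1 : 1 ≤ k)
    (hk : ∀ x, (t x).length ≤ k) (W : List (Letter S H)) :
    ∃ W' : List (Letter S' H), W'.length ≤ k * W.length ∧
      wordFree W' = substHom (fun x => wordFree (t x)) (wordFree W) := by
  induction W with
  | nil => exact ⟨[], by simp⟩
  | cons u W ih =>
    obtain ⟨W', hl, hW'⟩ := ih
    have : ∃ V : List (Letter S' H), V.length ≤ k ∧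
        wordFree V = substHom (fun x => wordFree (t x)) u.toFree := by
      rcases u with ⟨x, _ | _⟩ | ⟨i, h, hne⟩
      · exact ⟨wordInv (t x), by simpa using hk x, by simp [substHom, Letter.toFree]⟩
      · exact ⟨t x, hk x, by simp [substHom, Letter.toFree]⟩
      · exact ⟨[.per i h hne], by simpa using hk1, by simp⟩
    obtain ⟨V, hV, hV'⟩ := this
    refine ⟨V ++ W', ?_, by simp [hV', hW']⟩
    simp only [List.length_append, List.length_cons]
    linarith

lemma exists_uniform_loopBound {α : Type*} {a : S → G} {𝓡 : Set (List (Letter S H))} {s : Set α}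
    (hs : s.Finite) (F : α → FreeProd S H) (h : ∀ x ∈ s, ∃ n, LoopBound a 𝓡 (F x) n) :
    ∃ n, ∀ x ∈ s, LoopBound a 𝓡 (F x) n := by
  choose! n hn using h
  obtain ⟨N, hN⟩ := (hs.image n).bddAbove
  exact ⟨N, fun x hx => (hn x hx).mono (hN ⟨x, hx, rfl⟩)⟩

lemma exists_prod_conj_of_relDehn_le {a : S → G} {𝓡 : Set (List (Letter S H))} {B : ℕ}
    (hB : ∀ n : ℕ, relDehn a 𝓡 n ≤ ((B * n : ℕ) : ℕ∞)) {W : List (Letter S H)}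
    (hW : wordVal a W = 1) :
    ∃ L : List (FreeProd S H × List (Letter S H)), L.length ≤ B * W.length ∧
      (∀ c ∈ L, c.2 ∈ 𝓡) ∧ wordFree W = (L.map fun c => c.1⁻¹ * wordFree c.2 * c.1).prod := by
  have h1 : relArea 𝓡 W ≤ ((B * W.length : ℕ) : ℕ∞) :=
    (le_iSup (fun V : {V : List (Letter S H) // V.length ≤ W.length ∧ wordVal a V = 1} =>
      relArea 𝓡 V.1) ⟨W, le_rfl, hW⟩).trans (hB W.length)
  rw [relArea] at h1
  cases isEmpty_or_nonempty {L : List (FreeProd S H × List (Letter S H)) //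
      (∀ c ∈ L, c.2 ∈ 𝓡) ∧ wordFree W = (L.map fun c => c.1⁻¹ * wordFree c.2 * c.1).prod}
  -- With no expression as a product of conjugates, the area would be `⊤`, against the finite bound.
  · rw [iInf_of_empty] at h1
    exact absurd (top_le_iff.mp h1) (ENat.natCast_ne_top _)
  · obtain ⟨L, hL⟩ := ENat.exists_eq_iInf
      (fun L : {L : List (FreeProd S H × List (Letter S H)) //
      (∀ c ∈ L, c.2 ∈ 𝓡) ∧ wordFree W = (L.map fun c => c.1⁻¹ * wordFree c.2 * c.1).prod} =>
        (L.1.length : ℕ∞))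
    rw [← hL] at h1
    exact ⟨L.1, by exact_mod_cast h1, L.2⟩

/-- The linear relative isoperimetric inequality, for the variation of functions. -/
theorem exists_linear_loopBound {X : Set G} {𝓡 : Set (List (Letter X H))}
    (hpres : IsFiniteRelPresentation X H 𝓡) (hhyp : IsRelHyperbolic H) :
    ∃ A : ℕ, ∀ W : List (Letter X H), wordVal (fun x : X => (x : G)) W = 1 →
      LoopBound (fun x : X => (x : G)) 𝓡 (wordFree W) (A * W.length) := by
  obtain ⟨X', 𝓡', hpres', B, hB⟩ := hhyp
  set a : X → G := fun x => x with ha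
  set a' : X' → G := fun x => x with ha'
  have : Finite X := hpres.finite_gen
  choose t ht using fun x : X => exists_wordVal_eq hpres'.generates (x : G)
  -- `t` and `s` rewrite each generating set in terms of the other; the induced maps fix every
  -- peripheral factor.
  choose s hs using fun x : X' => exists_wordVal_eq hpres.generates (x : G)
  obtain ⟨k, hk⟩ := (Set.finite_range fun x => (t x).length).bddAbove
  let σ : FreeProd X' H →* FreeProd X H := substHom fun x => wordFree (s x)
  let τ : FreeProd X H →* FreeProd X' H := substHom fun x => wordFree (t x)
  have hσ : ∀ f, freeProj a H (σ f) = freeProj a' H f :=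
    freeProj_substHom fun x => by rw [freeProj_wordFree]; exact hs x
  have hτ : ∀ f, freeProj a' H (τ f) = freeProj a H f :=
    freeProj_substHom fun x => by rw [freeProj_wordFree]; exact ht x
  obtain ⟨A₁, hA₁⟩ := exists_uniform_loopBound (a := a) (𝓡 := 𝓡) hpres'.finite_rel
    (fun R => σ (wordFree R)) fun R hR => exists_loopBound hpres.kernel <| by
      rw [hσ]
      have : wordFree R ∈ (freeProj a' H).ker := by
        rw [← hpres'.kernel]; exact Subgroup.subset_normalClosure ⟨R, hR, rfl⟩
      exact this
  -- `σ ∘ τ` need not be the identity on X, but it is so on the peripheral factors; only finitely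
  -- many correction loops occur.
  obtain ⟨A₂, hA₂⟩ := exists_uniform_loopBound (a := a) (𝓡 := 𝓡)
    (Set.finite_univ (α := X × Bool))
    (fun x => σ (τ (Letter.gen x.1 x.2).toFree) * (Letter.gen x.1 x.2).toFree⁻¹)
    fun x _ => exists_loopBound hpres.kernel <| by rw [map_mul, hσ, hτ, map_inv, mul_inv_cancel]
  have hletter : ∀ u : Letter X H, LoopBound a 𝓡 (σ (τ u.toFree) * u.toFree⁻¹) A₂ := by
    rintro (⟨x, ε⟩ | ⟨i, h, hne⟩)
    · exact hA₂ (x, ε) trivial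
    · simpa [σ, τ] using LoopBound.one.mono (Nat.zero_le A₂)
  have hword : ∀ W : List (Letter X H),
      LoopBound a 𝓡 (σ (τ (wordFree W)) * (wordFree W)⁻¹) (A₂ * W.length) := by
    intro W
    induction W with
    | nil => simpa using LoopBound.one
    | cons u W ih =>
      -- The correction of a word is a product of conjugates of the corrections of its letters.
      have heq : σ (τ (wordFree (u :: W))) * (wordFree (u :: W))⁻¹ =
          σ (τ u.toFree) * (σ (τ (wordFree W)) * (wordFree W)⁻¹) * (σ (τ u.toFree))⁻¹ *
            (σ (τ u.toFree) * u.toFree⁻¹) := by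
        rw [wordFree_cons, map_mul, map_mul]
        group
      rw [heq, List.length_cons, mul_add, mul_one]
      exact (ih.conj (σ (τ u.toFree))).mul (hletter u)
  refine ⟨A₂ + A₁ * (B * (k + 1)), fun W hW => ?_⟩
  obtain ⟨W', hl, hW'⟩ := exists_substHom_word t (Nat.le_add_left 1 k)
    (fun x => (hk ⟨x, rfl⟩).trans (Nat.le_succ k)) W
  obtain ⟨L, hL, hLR, hprod⟩ := exists_prod_conj_of_relDehn_le hB (W := W') (by
    rw [← freeProj_wordFree, hW']
    exact (hτ _).trans (by rw [freeProj_wordFree]; exact hW))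
  have h1 : LoopBound a 𝓡 (σ (wordFree W')) (A₁ * L.length) := by
    rw [hprod, map_list_prod, List.map_map]
    refine LoopBound.list_prod _ _ fun c hc => ?_
    have := (hA₁ c.2 (hLR c hc)).conj (σ c.1)⁻¹
    simpa using this
  have h2 := (hword W).inv.mul h1
  have heq : (σ (τ (wordFree W)) * (wordFree W)⁻¹)⁻¹ * σ (wordFree W') = wordFree W := by
    rw [hW']
    change (σ (τ (wordFree W)) * (wordFree W)⁻¹)⁻¹ * σ (τ (wordFree W)) = _
    group
  rw [heq] at h2
  refine h2.mono ?_
  have : A₁ * L.length ≤ A₁ * (B * ((k + 1) * W.length)) :=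
    Nat.mul_le_mul_left _ (hL.trans (Nat.mul_le_mul_left _ hl))
  calc _ ≤ _ := Nat.add_le_add_left this _
    _ = _ := by ring

end Transfer

/-! ### Paths in the Cayley graph -/

section Paths

variable {G ι S : Type*} [Group G] {a : S → G} {H : ι → Subgroup G}

lemma CPath.vertex_add_one (p : CPath S H) {k : ℕ} {u : Letter S H} (hu : p.word[k]? = some u) :
    p.vertex a (k + 1) = p.vertex a k * u.val a := by
  obtain ⟨hk, rfl⟩ := List.getElem?_eq_some_iff.mp hu
  rw [CPath.vertex, CPath.vertex, ← List.take_concat_get' _ _ hk, wordVal_append]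
  simp [mul_assoc]

/-- Distinct edges labelled by letters of `H l` lie in distinct cosets of `H l`. -/
def CPath.HasSeparatedEdges (a : S → G) (p : CPath S H) : Prop :=
  ∀ l i j u v, i < j → p.word[i]? = some u → u.InFactor l → p.word[j]? = some v → v.InFactor l →
    (p.vertex a i)⁻¹ * p.vertex a j ∉ H l

lemma isSubword_succ {W : List (Letter S H)} {i : ℕ} {u : Letter S H} (hu : W[i]? = some u) {l : ι}
    (hl : u.InFactor l) : IsSubword W l i (i + 1) :=
  ⟨by omega, fun k hk hk' => ⟨u, by rwa [show k = i by omega], hl⟩⟩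

/-- Under local minimality every 𝓗-edge is a whole component, so two such edges in one coset would
be connected components. -/
lemma CPath.hasSeparatedEdges {p : CPath S H} (hmin : p.IsLocallyMinimal)
    (hback : p.WithoutBacktracking a) : p.HasSeparatedEdges a := by
  have hsyl : ∀ l i u, p.word[i]? = some u → u.InFactor l → IsSyllable p.word l i (i + 1) := by
    intro l i u hu hl
    obtain ⟨i', j', hi, hj, hs⟩ := (isSubword_succ hu hl).exists_isSyllable
    have := hmin l i' j' hs
    obtain rfl : i' = i := by omega
    obtain rfl : j' = i' + 1 := by omega
    exact hs
  intro l i j u v hij hu hul hv hvl hmem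
  obtain ⟨c, -, hc, hcv⟩ := exists_short_word (S := S) l ⟨_, hmem⟩
  refine hback l i (i + 1) j (j + 1) (hsyl l i u hu hul) (hsyl l j v hv hvl) ?_
    ⟨i, j, le_rfl, by omega, le_rfl, by omega, c, hc, ?_⟩
  · intro h
    have := congrArg Prod.fst h
    simp only at this
    omega
  · rw [← freeProj_wordFree, hcv]
    simp [freeProj]

lemma CPath.HasSeparatedEdges.isLocallyMinimal {p : CPath S H} (h : p.HasSeparatedEdges a) :
    p.IsLocallyMinimal := by
  intro l i j hs
  have hij := hs.1.1
  by_contra hne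
  obtain ⟨u, hu, hul⟩ := hs.1.2 i le_rfl hij
  obtain ⟨v, hv, hvl⟩ := hs.1.2 (i + 1) (by omega) (by omega)
  refine h l i (i + 1) u v (by omega) hu hul hv hvl ?_
  rw [p.vertex_add_one hu, inv_mul_cancel_left]
  exact hul.val_mem a

/-- Components have length 1, so all vertices of a component lie in the coset of its edge; connected
components share that coset. -/
lemma CPath.HasSeparatedEdges.withoutBacktracking {p : CPath S H} (h : p.HasSeparatedEdges a) :
    p.WithoutBacktracking a := by
  rintro l i j i' j' hs hs' hne ⟨k, k', hk, hkj, hk', hkj', c, hc, hv⟩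
  have e1 := h.isLocallyMinimal l i j hs
  have e2 := h.isLocallyMinimal l i' j' hs'
  have hmem := wordVal_mem a hc
  have key : ∀ i j k, IsSyllable p.word l i j → j - i = 1 → i ≤ k → k ≤ j →
      (p.vertex a i)⁻¹ * p.vertex a k ∈ H l := by
    intro i j k hs he hk hkj
    obtain ⟨u, hu, hul⟩ := hs.1.2 i le_rfl hs.1.1
    rcases (by omega : k = i ∨ k = i + 1) with rfl | rfl
    · simp
    · rw [p.vertex_add_one hu, inv_mul_cancel_left]
      exact hul.val_mem a
  have h1 := key i j k hs e1 hk hkj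
  have h2 := key i' j' k' hs' e2 hk' hkj'
  have h3 : (p.vertex a i)⁻¹ * p.vertex a i' ∈ H l := by
    have := mul_mem (mul_mem h1 hmem) (inv_mem h2)
    rw [← hv] at this
    convert this using 1
    group
  obtain ⟨u, hu, hul⟩ := hs.1.2 i le_rfl hs.1.1
  obtain ⟨v, hv, hvl⟩ := hs'.1.2 i' le_rfl hs'.1.1
  rcases lt_trichotomy i i' with hlt | rfl | hlt
  · exact h l i i' u v hlt hu hul hv hvl h3
  · exact hne (by rw [Prod.mk.injEq]; omega)
  · refine h l i' i v u hlt hv hvl hu hul ?_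
    have := inv_mem h3
    rwa [mul_inv_rev, inv_inv] at this

/-! ### Distances of points -/

lemma pointDist_le_outer (e f : G × Letter S H) (s t : ℝ) :
    pointDist a e s f t ≤ min
    (min (s + vdist a H e.1 f.1 + t) (s + vdist a H e.1 (edgeEnd a f) + (1 - t)))
    (min ((1 - s) + vdist a H (edgeEnd a e) f.1 + t)
      ((1 - s) + vdist a H (edgeEnd a e) (edgeEnd a f) + (1 - t))) := by
  unfold pointDist
  dsimp only
  split_ifs
  · exact min_le_right _ _
  · exact min_le_right _ _
  · exact le_rfl

lemma pointDist_zero_le (e f : G × Letter S H) : pointDist a e 0 f 0 ≤ vdist a H e.1 f.1 := by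
  have h := (pointDist_le_outer (a := a) e f 0 0).trans ((min_le_left _ _).trans (min_le_left _ _))
  simpa using h

lemma vdist_edgeEnd_le (e : G × Letter S H) : vdist a H e.1 (edgeEnd a e) ≤ 1 :=
  vdist_le a [e.2] (by simp [edgeEnd])

/-- Each of the two points is within distance 1 of the origin of its edge. -/
lemma vdist_sub_two_le_pointDist (hgen : IsRelGenerating a H) (e f : G × Letter S H) {s t : ℝ}
    (hs : s ∈ Set.Icc (0 : ℝ) 1) (ht : t ∈ Set.Icc (0 : ℝ) 1) :
    (vdist a H e.1 f.1 : ℝ) - 2 ≤ pointDist a e s f t := by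
  obtain ⟨hs0, hs1⟩ := hs
  obtain ⟨ht0, ht1⟩ := ht
  have he : (vdist a H e.1 (edgeEnd a e) : ℝ) ≤ 1 := by exact_mod_cast vdist_edgeEnd_le e
  have hf : (vdist a H (edgeEnd a f) f.1 : ℝ) ≤ 1 := by
    rw [vdist_comm hgen]; exact_mod_cast vdist_edgeEnd_le f
  have tri : ∀ x y z : G, (vdist a H x z : ℝ) ≤ vdist a H x y + vdist a H y z :=
    fun x y z => by exact_mod_cast vdist_triangle hgen x y z
  have houter : (vdist a H e.1 f.1 : ℝ) - 2 ≤ min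
      (min (s + vdist a H e.1 f.1 + t) (s + vdist a H e.1 (edgeEnd a f) + (1 - t)))
      (min ((1 - s) + vdist a H (edgeEnd a e) f.1 + t)
        ((1 - s) + vdist a H (edgeEnd a e) (edgeEnd a f) + (1 - t))) := by
    refine le_min (le_min ?_ ?_) (le_min ?_ ?_)
    · linarith
    · linarith [tri e.1 (edgeEnd a f) f.1]
    · linarith [tri e.1 (edgeEnd a e) f.1]
    · linarith [tri e.1 (edgeEnd a e) f.1, tri (edgeEnd a e) (edgeEnd a f) f.1]
  unfold pointDist
  dsimp only
  split_ifs with h1 h2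
  · refine le_min ?_ houter
    subst h1
    have h0 : vdist a H f.1 f.1 ≤ 0 := vdist_le a [] (by simp)
    have h0' : (vdist a H f.1 f.1 : ℝ) ≤ 0 := by exact_mod_cast h0
    linarith [abs_nonneg (s - t)]
  · refine le_min ?_ houter
    subst h2
    change (vdist a H e.1 (edgeEnd a e) : ℝ) - 2 ≤ _
    linarith [abs_nonneg (s - (1 - t))]
  · exact houter

lemma CPath.exists_word_between (p : CPath S H) {i j : ℕ} (hij : i ≤ j) :
    ∃ W : List (Letter S H), W.length ≤ j - i ∧ wordFree (p.word.take i ++ W) =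
      wordFree (p.word.take j) ∧ p.vertex a i * wordVal a W = p.vertex a j := by
  refine ⟨(p.word.take j).drop i, by simp; omega, ?_, ?_⟩
  · congr 1
    conv_rhs => rw [← List.take_append_drop i (p.word.take j)]
    rw [List.take_take, min_eq_left hij]
  · simp only [CPath.vertex, mul_assoc]
    rw [wordVal_drop_take a p.word hij]

lemma CPath.vdist_vertex_le (p : CPath S H) {i j : ℕ} (hij : i ≤ j) :
    vdist a H (p.vertex a i) (p.vertex a j) ≤ j - i := by
  obtain ⟨W, hW, -, hv⟩ := p.exists_word_between (a := a) hij
  exact (vdist_le a W hv).trans hW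

lemma CPath.edgeEnd_edge (p : CPath S H) {i : ℕ} (hi : i < p.word.length) :
    edgeEnd a (p.edge a i hi) = p.vertex a (i + 1) :=
  (p.vertex_add_one (List.getElem?_eq_getElem hi)).symm

/-- The path itself joins the two points, so the upper quasigeodesic inequality is automatic. -/
lemma CPath.pointDist_le (hgen : IsRelGenerating a H) (p : CPath S H) {i j : ℕ}
    (hi : i < p.word.length) (hj : j < p.word.length) {s t : ℝ}
    (hs : s ∈ Set.Icc (0 : ℝ) 1) (ht : t ∈ Set.Icc (0 : ℝ) 1) :
    pointDist a (p.edge a i hi) s (p.edge a j hj) t ≤ |((i : ℝ) + s) - ((j : ℝ) + t)| := by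
  obtain ⟨hs0, hs1⟩ := hs
  obtain ⟨ht0, ht1⟩ := ht
  have hcast : ∀ {k l : ℕ}, k + 1 ≤ l →
      (vdist a H (p.vertex a (k + 1)) (p.vertex a l) : ℝ) ≤ l - (k + 1) := by
    intro k l hkl
    have := p.vdist_vertex_le (a := a) hkl
    have h2 : vdist a H (p.vertex a (k + 1)) (p.vertex a l) + (k + 1) ≤ l := by omega
    have h3 : (vdist a H (p.vertex a (k + 1)) (p.vertex a l) : ℝ) + (k + 1) ≤ l := by
      exact_mod_cast h2
    linarith
  rcases lt_trichotomy i j with hlt | rfl | hlt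
  · refine (pointDist_le_outer _ _ _ _).trans
      ((min_le_right _ _).trans ((min_le_left _ _).trans ?_))
    rw [p.edgeEnd_edge hi]
    refine le_trans ?_ (neg_le_abs _)
    have := hcast hlt
    change 1 - s + (vdist a H (p.vertex a (i + 1)) (p.vertex a j) : ℝ) + t ≤ _
    linarith
  · unfold pointDist
    simp only [if_true]
    refine (min_le_left _ _).trans (le_of_eq ?_)
    congr 1
    ring
  · refine (pointDist_le_outer _ _ _ _).trans
      ((min_le_left _ _).trans ((min_le_right _ _).trans ?_))
    rw [p.edgeEnd_edge hj, vdist_comm hgen]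
    refine le_trans ?_ (le_abs_self _)
    have := hcast hlt
    change s + (vdist a H (p.vertex a (j + 1)) (p.vertex a i) : ℝ) + (1 - t) ≤ _
    linarith

lemma CPath.IsQuasigeodesic.sub_le {α β : ℝ} {p : CPath S H} (hp : p.IsQuasigeodesic a α β)
    (hα : 1 ≤ α) {i j : ℕ} (hi : i < p.word.length) (hj : j < p.word.length) :
    (j : ℝ) - i ≤ α * (vdist a H (p.vertex a i) (p.vertex a j) + β) := by
  have h := (hp i j hi hj 0 (by simp) 0 (by simp)).1.trans (pointDist_zero_le _ _)
  change 1 / α * |(i : ℝ) + 0 - (j + 0)| - β ≤ (vdist a H (p.vertex a i) (p.vertex a j) : ℝ) at h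
  have h0 : 0 < α := by linarith
  have h1 : 1 / α * |(i : ℝ) + 0 - (j + 0)| ≤ vdist a H (p.vertex a i) (p.vertex a j) + β := by
    linarith
  rw [one_div, inv_mul_le_iff₀ h0] at h1
  refine le_trans ?_ h1
  refine le_trans ?_ (neg_le_abs _)
  linarith

/-- Of the extra 3, rounding the parameters down to integers costs 1, and replacing the points by
the origins of their edges costs 2. Every point lies on an edge, so only vertices that are origins
of edges need testing, whence `j < p.word.length`. -/
lemma CPath.isQuasigeodesic_of_sub_le (hgen : IsRelGenerating a H) {C D : ℝ} {p : CPath S H}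
    (hC : 1 ≤ C) (hD : 0 ≤ D)
    (h : ∀ i j, i ≤ j → j < p.word.length →
      (j : ℝ) - i ≤ C * vdist a H (p.vertex a i) (p.vertex a j) + D) :
    p.IsQuasigeodesic a C (D + 3) := by
  have habs : ∀ i j, i < p.word.length → j < p.word.length →
      |(i : ℝ) - j| ≤ C * vdist a H (p.vertex a i) (p.vertex a j) + D := by
    intro i j hi hj
    rcases le_total i j with hij | hij
    · rw [abs_sub_comm, abs_of_nonneg (sub_nonneg.mpr (by exact_mod_cast hij))]
      exact h i j hij hj
    · rw [abs_of_nonneg (sub_nonneg.mpr (by exact_mod_cast hij)), vdist_comm hgen]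
      exact h j i hij hi
  intro i j hi hj s hs t ht
  constructor
  · refine le_trans ?_ (vdist_sub_two_le_pointDist hgen _ _ hs ht)
    change _ ≤ (vdist a H (p.vertex a i) (p.vertex a j) : ℝ) - 2
    have h1 : |(i : ℝ) + s - (j + t)| ≤ |(i : ℝ) - j| + 1 := by
      have : (i : ℝ) + s - (j + t) = (i - j) + (s - t) := by ring
      rw [this]
      refine (abs_add_le _ _).trans (add_le_add_right ?_ _)
      rw [abs_le]
      constructor <;> linarith [hs.1, hs.2, ht.1, ht.2]
    have h2 : |(i : ℝ) + s - (j + t)| ≤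
        C * (vdist a H (p.vertex a i) (p.vertex a j) + (D + 1)) := by
      have := habs i j hi hj
      nlinarith
    have h3 : 1 / C * |(i : ℝ) + s - (j + t)| ≤
        vdist a H (p.vertex a i) (p.vertex a j) + (D + 1) := by
      rw [one_div, inv_mul_le_iff₀ (by linarith)]
      exact h2
    linarith
  · refine (p.pointDist_le hgen hi hj hs ht).trans ?_
    nlinarith [abs_nonneg ((i : ℝ) + s - (j + t))]

end Paths

/-! ### Reading Ω ⊔ 𝓚 inside 𝓗, and the lifts of single edges -/

section Lifts

variable {G Λ : Type*} [Group G] {X : Set G} {H : Λ → Subgroup G} {𝓡 : Set (List (Letter X H))}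
  {M : Λ → Type*} {K : ∀ l, M l → Subgroup G}

/-- The letter of `X ⊔ 𝓗` given by a letter of `X ⊔ Ω ⊔ 𝓚`. -/
def Letter.proj (hK : ∀ l m, K l m ≤ H l) : Letter (GenOm X 𝓡) (famK K) → Letter X H
  | .gen (.inl x) ε => .gen x ε
  | .gen (.inr w) true => .per w.1 ⟨w.2, w.2.2.1⟩ fun e => w.2.2.2.1 (congrArg Subtype.val e)
  | .gen (.inr w) false => .per w.1 ⟨w.2, w.2.2.1⟩⁻¹
      (inv_ne_one.mpr fun e => w.2.2.2.1 (congrArg Subtype.val e))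
  | .per lm h hne => .per lm.1 ⟨h, hK lm.1 lm.2 h.2⟩ fun e =>
      hne (Subtype.ext (show (h : G) = 1 from congrArg Subtype.val e))

@[simp] lemma Letter.val_proj (hK : ∀ l m, K l m ≤ H l) (u : Letter (GenOm X 𝓡) (famK K)) :
    (u.proj hK).val (fun x : X => (x : G)) = u.val (genOmVal X 𝓡) := by
  rcases u with ⟨x | w, _ | _⟩ | ⟨lm, h, hne⟩ <;> simp [Letter.proj, Letter.val, genOmVal]

@[simp] lemma wordVal_map_proj (hK : ∀ l m, K l m ≤ H l)
    (W : List (Letter (GenOm X 𝓡) (famK K))) :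
    wordVal (fun x : X => (x : G)) (W.map (Letter.proj hK)) = wordVal (genOmVal X 𝓡) W := by
  induction W with
  | nil => simp
  | cons u W ih => simp [ih]

lemma OverLocal.inFactor_proj (hK : ∀ l m, K l m ≤ H l) {l : Λ}
    {u : Letter (GenOm X 𝓡) (famK K)} (hu : OverLocal l u) : (u.proj hK).InFactor l := by
  rcases u with ⟨x | w, _ | _⟩ | ⟨lm, h, hne⟩
  · exact hu.elim
  · exact hu.elim
  all_goals exact hu

lemma OverLocal.inv {l : Λ} {u : Letter (GenOm X 𝓡) (famK K)} (hu : OverLocal l u) :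
    OverLocal l u.inv := by
  rcases u with ⟨x | w, _ | _⟩ | ⟨lm, h, hne⟩
  · exact hu.elim
  · exact hu.elim
  all_goals exact hu

lemma OverLocal.val_mem (hK : ∀ l m, K l m ≤ H l) {l : Λ}
    {u : Letter (GenOm X 𝓡) (famK K)} (hu : OverLocal l u) : u.val (genOmVal X 𝓡) ∈ H l := by
  rw [← Letter.val_proj hK]
  exact (hu.inFactor_proj hK).val_mem _

lemma Letter.InFactor.overLocal {lm : Σ l, M l} {u : Letter (GenOm X 𝓡) (famK K)}
    (hu : u.InFactor lm) : OverLocal lm.1 u := by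
  rcases u with ⟨x, ε⟩ | ⟨lm', h, hne⟩
  · exact hu.elim
  · obtain rfl : lm' = lm := hu
    rfl

lemma wordVal_mem_of_overLocal (hK : ∀ l m, K l m ≤ H l) {l : Λ}
    {W : List (Letter (GenOm X 𝓡) (famK K))} (hW : ∀ u ∈ W, OverLocal l u) :
    wordVal (genOmVal X 𝓡) W ∈ H l := by
  rw [← wordVal_map_proj hK]
  refine wordVal_mem _ fun u hu => ?_
  obtain ⟨v, hv, rfl⟩ := List.mem_map.mp hu
  exact (hW v hv).inFactor_proj hK

lemma isRelGenerating_genOm (𝓡 : Set (List (Letter X H)))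
    (hgen : IsRelGenerating (fun x : X => (x : G)) (famK K)) :
    IsRelGenerating (genOmVal X 𝓡) (famK K) := by
  refine top_le_iff.mp (hgen.symm.le.trans (Subgroup.closure_mono ?_))
  refine Set.union_subset_union_left _ ?_
  rintro _ ⟨x, rfl⟩
  exact ⟨.inl x, rfl⟩

/-! ### Functions that are Lipschitz along `Ω ⊔ 𝓚` -/

/-- `φ l` varies by at most `c` along the edges labelled by `Ω_l ⊔ 𝓚_l`. -/
def LocalLipschitz (𝓡 : Set (List (Letter X H))) (K : ∀ l, M l → Subgroup G)
    (φ : Λ → G → ℤ) (c : ℤ) : Prop :=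
  0 ≤ c ∧ ∀ l g (u : Letter (GenOm X 𝓡) (famK K)), OverLocal l u →
    |φ l (g * u.val (genOmVal X 𝓡)) - φ l g| ≤ c

variable {φ : Λ → G → ℤ} {c : ℤ}

lemma LocalLipschitz.omLipschitz (h : LocalLipschitz 𝓡 K φ c) :
    OmLipschitz (fun x : X => (x : G)) 𝓡 φ c :=
  ⟨h.1, fun l g w hw => h.2 l g (.gen (.inr ⟨l, w, hw⟩) true) rfl⟩

lemma LocalLipschitz.abs_variation_le (h : LocalLipschitz 𝓡 K φ c) (hK : ∀ l m, K l m ≤ H l)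
    (W : List (Letter (GenOm X 𝓡) (famK K))) (g : G) :
    |variation (fun x : X => (x : G)) φ g (wordFree (W.map (Letter.proj hK)))| ≤ c * W.length := by
  induction W generalizing g with
  | nil => simp
  | cons u W ih =>
    rw [List.map_cons, wordFree_cons, variation_mul, List.length_cons]
    refine (abs_add_le _ _).trans ?_
    have h1 : |variation (fun x : X => (x : G)) φ g (u.proj hK).toFree| ≤ c := by
      have hloc : ∀ l, OverLocal l u →
          |variation (fun x : X => (x : G)) φ g (u.proj hK).toFree| ≤ c := fun l hl => by
        rw [variation_eq_of_inFactor _ _ _ (hl.inFactor_proj hK), Letter.val_proj]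
        exact h.2 l g u hl
      rcases u with ⟨x | w, ε⟩ | ⟨lm, k, hne⟩
      · simpa [Letter.proj] using h.1
      · exact hloc w.1 rfl
      · exact hloc lm.1 rfl
    have := ih (g * freeProj (fun x : X => (x : G)) H (u.proj hK).toFree)
    push_cast
    linarith

/-- Every subgroup `H l` is generated by `Ω_l ⊔ 𝓚_l`. -/
lemma exists_local_word (hK : ∀ l m, K l m ≤ H l)
    (hpres : IsFiniteRelPresentation X H 𝓡)
    (hgen : IsRelGenerating (fun x : X => (x : G)) (famK K)) {l : Λ} {h : G} (hh : h ∈ H l) :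
    ∃ V : List (Letter (GenOm X 𝓡) (famK K)), (∀ u ∈ V, OverLocal l u) ∧
      wordVal (genOmVal X 𝓡) V = h := by
  classical
  let Q : Λ → G → Prop := fun k g => ∃ V : List (Letter (GenOm X 𝓡) (famK K)),
    (∀ u ∈ V, OverLocal k u) ∧ wordVal (genOmVal X 𝓡) V = g
  -- The indicator function of the elements expressible over Ω_l ⊔ 𝓚_l; it is constant along edges
  -- with such labels, so its Lipschitz constant is 0.
  let φ : Λ → G → ℤ := fun k g => if Q k g ∧ k = l then 1 else 0
  have hQ : ∀ k g (u : Letter (GenOm X 𝓡) (famK K)), OverLocal k u → Q k g →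
      Q k (g * u.val (genOmVal X 𝓡)) := by
    rintro k _ u hu ⟨V, hV, rfl⟩
    refine ⟨V ++ [u], fun v hv => ?_, by simp⟩
    rcases List.mem_append.mp hv with hv | hv
    · exact hV v hv
    · rwa [List.mem_singleton.mp hv]
  have hφ : LocalLipschitz 𝓡 K φ 0 := by
    refine ⟨le_rfl, fun k g u hu => ?_⟩
    have : Q k (g * u.val (genOmVal X 𝓡)) ↔ Q k g :=
      ⟨fun hq => by simpa using hQ k _ u.inv hu.inv hq, hQ k g u hu⟩
    simp [φ, this]
  obtain ⟨W, hW⟩ := exists_wordVal_eq (isRelGenerating_genOm 𝓡 hgen) h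
  -- The loop goes out along the single element h and returns along a word over X ⊔ Ω ⊔ 𝓚. With
  -- constant 0 both parts have variation 0, hence `φ l h = φ l 1`.
  obtain ⟨n, hn⟩ := exists_loopBound (a := fun x : X => (x : G)) hpres.kernel
    (f := Monoid.Coprod.inr (Monoid.CoprodI.of (i := l) ⟨h, hh⟩) *
      (wordFree (W.map (Letter.proj hK)))⁻¹) (by
        rw [map_mul, map_inv, freeProj_wordFree, wordVal_map_proj, hW]
        simp [freeProj])
  have h0 := hn.2 φ 0 hφ.omLipschitz 1
  rw [variation_mul, variation_inv, variation_inr_of] at h0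
  have h1 := fun g => hφ.abs_variation_le hK W g
  simp only [zero_mul, abs_nonpos_iff] at h0 h1
  rw [h1, neg_zero, add_zero, one_mul] at h0
  have hone : φ l 1 = 1 := if_pos ⟨⟨[], by simp⟩, rfl⟩
  have hφh : φ l h = 1 := by simpa [hone, sub_eq_zero] using h0
  by_contra hcon
  have : φ l h = 0 := if_neg fun hq => hcon hq.1
  omega

/-! ### Lengths in `Γ(H_l, Ω_l ⊔ 𝓚_l)` -/

/-- The word length with respect to `Ω_l ⊔ 𝓚_l`. -/
noncomputable def localLen (𝓡 : Set (List (Letter X H))) (K : ∀ l, M l → Subgroup G) (l : Λ)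
    (h : G) : ℕ :=
  sInf {n | ∃ V : List (Letter (GenOm X 𝓡) (famK K)), (∀ u ∈ V, OverLocal l u) ∧
    wordVal (genOmVal X 𝓡) V = h ∧ V.length = n}

lemma localLen_le {l : Λ} {h : G} {V : List (Letter (GenOm X 𝓡) (famK K))}
    (hV : ∀ u ∈ V, OverLocal l u) (hVh : wordVal (genOmVal X 𝓡) V = h) :
    localLen 𝓡 K l h ≤ V.length :=
  Nat.sInf_le ⟨V, hV, hVh, rfl⟩

lemma localLen_one (l : Λ) : localLen 𝓡 K l 1 = 0 :=
  Nat.le_zero.mp (localLen_le (V := []) (by simp) rfl)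

lemma exists_word_localLen {l : Λ} {h : G}
    (hex : ∃ V : List (Letter (GenOm X 𝓡) (famK K)), (∀ u ∈ V, OverLocal l u) ∧
      wordVal (genOmVal X 𝓡) V = h) :
    ∃ V : List (Letter (GenOm X 𝓡) (famK K)), (∀ u ∈ V, OverLocal l u) ∧
      wordVal (genOmVal X 𝓡) V = h ∧ V.length = localLen 𝓡 K l h := by
  obtain ⟨V, hV, hVh⟩ := hex
  exact Nat.sInf_mem (s := {n | ∃ V : List (Letter (GenOm X 𝓡) (famK K)),
    (∀ u ∈ V, OverLocal l u) ∧ wordVal (genOmVal X 𝓡) V = h ∧ V.length = n}) ⟨_, V, hV, hVh, rfl⟩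

lemma exists_isLocalGeodesic {l : Λ} {h : G}
    (hex : ∃ V : List (Letter (GenOm X 𝓡) (famK K)), (∀ u ∈ V, OverLocal l u) ∧
      wordVal (genOmVal X 𝓡) V = h) : ∃ V, IsLocalGeodesic 𝓡 K l h V := by
  obtain ⟨V, hV, hVh, hl⟩ := exists_word_localLen hex
  exact ⟨V, ⟨hV, hVh⟩, fun V' hV' hVh' => hl.le.trans (localLen_le hV' hVh')⟩

/-- An initial segment of a geodesic is geodesic: a shorter word for it would shorten the whole. -/
lemma IsLocalGeodesic.length_take {l : Λ} {h : G} {V : List (Letter (GenOm X 𝓡) (famK K))}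
    (hV : IsLocalGeodesic 𝓡 K l h V) (r : ℕ) :
    localLen 𝓡 K l (wordVal (genOmVal X 𝓡) (V.take r)) = (V.take r).length := by
  refine le_antisymm (localLen_le (fun u hu => hV.1.1 u (List.mem_of_mem_take hu)) rfl) ?_
  obtain ⟨U, hU, hUv, hl⟩ := exists_word_localLen (𝓡 := 𝓡) (K := K) (l := l)
    ⟨V.take r, fun u hu => hV.1.1 u (List.mem_of_mem_take hu), rfl⟩
  have := hV.2 (U ++ V.drop r) (fun u hu => by
    rcases List.mem_append.mp hu with hu | hu
    · exact hU u hu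
    · exact hV.1.1 u (List.mem_of_mem_drop hu)) (by
      rw [wordVal_append, hUv, ← wordVal_append, List.take_append_drop, hV.1.2])
  have h2 := congrArg List.length (List.take_append_drop r V)
  simp only [List.length_append] at this h2
  omega

/-- The existence hypothesis rules out the default value 0 of `sInf` on the empty set. -/
lemma abs_localLen_mul_sub_le {l : Λ} {h : G} {u : Letter (GenOm X 𝓡) (famK K)}
    (hu : OverLocal l u)
    (hex : ∃ V : List (Letter (GenOm X 𝓡) (famK K)), (∀ u ∈ V, OverLocal l u) ∧
      wordVal (genOmVal X 𝓡) V = h) :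
    |(localLen 𝓡 K l (h * u.val (genOmVal X 𝓡)) : ℤ) - localLen 𝓡 K l h| ≤ 1 := by
  have key : ∀ (g : G) (v : Letter (GenOm X 𝓡) (famK K)), OverLocal l v →
      (∃ V : List (Letter (GenOm X 𝓡) (famK K)), (∀ u ∈ V, OverLocal l u) ∧
        wordVal (genOmVal X 𝓡) V = g) →
      (∃ V : List (Letter (GenOm X 𝓡) (famK K)), (∀ u ∈ V, OverLocal l u) ∧
        wordVal (genOmVal X 𝓡) V = g * v.val (genOmVal X 𝓡)) ∧
      localLen 𝓡 K l (g * v.val (genOmVal X 𝓡)) ≤ localLen 𝓡 K l g + 1 := by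
    intro g v hv hg
    obtain ⟨V, hV, hVg, hl⟩ := exists_word_localLen hg
    have h1 : ∀ w ∈ V ++ [v], OverLocal l w := fun w hw => by
      rcases List.mem_append.mp hw with hw | hw
      · exact hV w hw
      · rwa [List.mem_singleton.mp hw]
    have h2 : wordVal (genOmVal X 𝓡) (V ++ [v]) = g * v.val (genOmVal X 𝓡) := by simp [hVg]
    exact ⟨⟨_, h1, h2⟩, (localLen_le h1 h2).trans (by simp [hl])⟩
  obtain ⟨hex', h1⟩ := key h u hu hex
  have h2 := (key _ u.inv hu.inv hex').2
  rw [Letter.val_inv, mul_inv_cancel_right] at h2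
  rw [abs_le]
  constructor <;> omega

/-! ### The length function along a path -/

/-- The edge number `k` of `p` is labelled by a letter of `H l`, and `x` lies in its coset. -/
def CPath.EdgeCoset (p : CPath X H) (l : Λ) (x : G) (k : ℕ) : Prop :=
  ∃ u, p.word[k]? = some u ∧ u.InFactor l ∧ (p.vertex (fun x : X => (x : G)) k)⁻¹ * x ∈ H l

open Classical in
/-- On the coset of an edge of `p` labelled by a letter of `H l`, the distance to the origin of
this edge with respect to `Ω_l ⊔ 𝓚_l`. -/
noncomputable def edgeDist (𝓡 : Set (List (Letter X H))) (K : ∀ l, M l → Subgroup G)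
    (p : CPath X H) (l : Λ) (x : G) : ℤ :=
  if h : ∃ k, p.EdgeCoset l x k then
    localLen 𝓡 K l ((p.vertex (fun x : X => (x : G)) h.choose)⁻¹ * x) else 0

lemma CPath.HasSeparatedEdges.edgeCoset_unique {p : CPath X H}
    (hp : p.HasSeparatedEdges (fun x : X => (x : G))) {l : Λ} {x : G} {k k' : ℕ}
    (hk : p.EdgeCoset l x k) (hk' : p.EdgeCoset l x k') : k = k' := by
  obtain ⟨u, hu, hul, hux⟩ := hk
  obtain ⟨v, hv, hvl, hvx⟩ := hk'
  rcases lt_trichotomy k k' with hlt | rfl | hlt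
  · refine absurd ?_ (hp l k k' u v hlt hu hul hv hvl)
    have := mul_mem hux (inv_mem hvx)
    convert this using 1
    group
  · rfl
  · refine absurd ?_ (hp l k' k v u hlt hv hvl hu hul)
    have := mul_mem hvx (inv_mem hux)
    convert this using 1
    group

/-- Separation makes the edge over a coset unique, so the choice in `edgeDist` is immaterial. -/
lemma CPath.HasSeparatedEdges.edgeDist_eq {p : CPath X H}
    (hp : p.HasSeparatedEdges (fun x : X => (x : G))) {l : Λ} {x : G} {k : ℕ}
    (hk : p.EdgeCoset l x k) :
    edgeDist 𝓡 K p l x = localLen 𝓡 K l ((p.vertex (fun x : X => (x : G)) k)⁻¹ * x) := by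
  have h : ∃ k, p.EdgeCoset l x k := ⟨k, hk⟩
  rw [edgeDist, dif_pos h, hp.edgeCoset_unique h.choose_spec hk]

lemma CPath.HasSeparatedEdges.localLipschitz_edgeDist {p : CPath X H}
    (hp : p.HasSeparatedEdges (fun x : X => (x : G))) (hK : ∀ l m, K l m ≤ H l)
    (hex : ∀ l, ∀ h ∈ H l, ∃ V : List (Letter (GenOm X 𝓡) (famK K)),
      (∀ u ∈ V, OverLocal l u) ∧ wordVal (genOmVal X 𝓡) V = h) :
    LocalLipschitz 𝓡 K (edgeDist 𝓡 K p) 1 := by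
  refine ⟨zero_le_one, fun l x u hu => ?_⟩
  have hiff : ∀ k, p.EdgeCoset l (x * u.val (genOmVal X 𝓡)) k ↔ p.EdgeCoset l x k := by
    intro k
    simp only [CPath.EdgeCoset, ← mul_assoc, Subgroup.mul_mem_cancel_right _ (hu.val_mem hK)]
  by_cases h : ∃ k, p.EdgeCoset l x k
  · obtain ⟨k, hk⟩ := h
    rw [hp.edgeDist_eq hk, hp.edgeDist_eq ((hiff k).mpr hk), ← mul_assoc]
    obtain ⟨v, -, -, hmem⟩ := hk
    exact abs_localLen_mul_sub_le hu (hex l _ hmem)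
  · rw [edgeDist, edgeDist, dif_neg h, dif_neg (by simpa [hiff] using h)]
    simp

/-! ### Positions in a lift -/

lemma exists_position_flatten {α : Type*} (Vs : List (List α)) {n : ℕ}
    (hn : n < Vs.flatten.length) :
    ∃ (i : ℕ) (hi : i < Vs.length) (r : ℕ) (_ : r < Vs[i].length),
      Vs.flatten.take n = (Vs.take i).flatten ++ Vs[i].take r ∧
      Vs.flatten[n]? = Vs[i][r]? ∧ n = (Vs.take i).flatten.length + r := by
  induction Vs generalizing n with
  | nil => simp at hn
  | cons V Vs ih =>
    rw [List.flatten_cons] at hn ⊢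
    rcases Nat.lt_or_ge n V.length with h | h
    · refine ⟨0, by simp, n, by simpa using h, ?_, ?_, by simp⟩
      · simp [List.take_append_of_le_length h.le]
      · simp [List.getElem?_append_left h]
    · rw [List.length_append] at hn
      obtain ⟨i, hi, r, hr, h1, h2, h3⟩ := ih (n := n - V.length) (by omega)
      refine ⟨i + 1, by simpa using hi, r, by simpa using hr, ?_, ?_, ?_⟩
      · rw [List.take_append, List.take_of_length_le h, h1]
        simp
      · rw [List.getElem?_append_right h, h2]
        simp
      · rw [List.take_succ_cons, List.flatten_cons, List.length_append]
        omega

lemma length_flatten_take_mono {α : Type*} (Vs : List (List α)) {i j : ℕ} (hij : i ≤ j) :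
    (Vs.take i).flatten.length ≤ (Vs.take j).flatten.length := by
  have : (Vs.take i) <+: (Vs.take j) := List.take_prefix_take_left hij
  obtain ⟨t, ht⟩ := this
  rw [← ht]
  simp

lemma IsEdgeLift.wordVal_eq {u : Letter X H} {V : List (Letter (GenOm X 𝓡) (famK K))}
    (h : IsEdgeLift 𝓡 K u V) :
    wordVal (genOmVal X 𝓡) V = u.val (fun x : X => (x : G)) := by
  rcases u with ⟨x, ε⟩ | ⟨l, k, hne⟩
  · obtain rfl : V = [.gen (.inl x) ε] := h
    cases ε <;> simp [Letter.val, genOmVal]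
  · exact h.1.2

lemma wordVal_flatten_of_forall₂ {W : List (Letter X H)}
    {Vs : List (List (Letter (GenOm X 𝓡) (famK K)))} (h : List.Forall₂ (IsEdgeLift 𝓡 K) W Vs) :
    wordVal (genOmVal X 𝓡) Vs.flatten = wordVal (fun x : X => (x : G)) W := by
  induction h with
  | nil => rfl
  | cons hu _ ih => rw [List.flatten_cons, wordVal_append, wordVal_cons, ih, hu.wordVal_eq]

lemma exists_isMinimalLift
    (hex : ∀ l, ∀ h ∈ H l, ∃ V : List (Letter (GenOm X 𝓡) (famK K)),
      (∀ u ∈ V, OverLocal l u) ∧ wordVal (genOmVal X 𝓡) V = h) (p : CPath X H) :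
    ∃ q, IsMinimalLift 𝓡 K p q := by
  have hlift : ∀ u : Letter X H, ∃ V, IsEdgeLift 𝓡 K u V := by
    rintro (⟨x, ε⟩ | ⟨l, h, hne⟩)
    · exact ⟨_, rfl⟩
    · exact exists_isLocalGeodesic (hex l h h.2)
  choose F hF using hlift
  refine ⟨⟨p.start, (p.word.map F).flatten⟩, rfl, p.word.map F, ?_, rfl⟩
  rw [List.forall₂_map_right_iff]
  exact List.forall₂_same.mpr fun u _ => hF u

/-- A vertex of a lift, as seen from the origin of the edge of `p` over which it lies. -/
lemma exists_short_word_block {p : CPath X H} (hK : ∀ l m, K l m ≤ H l)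
    (hp : p.HasSeparatedEdges (fun x : X => (x : G))) {i : ℕ} {u : Letter X H}
    (hu : p.word[i]? = some u) {V : List (Letter (GenOm X 𝓡) (famK K))}
    (hV : IsEdgeLift 𝓡 K u V) {r : ℕ} (hr : r < V.length) :
    ∃ W : List (Letter X H), W.length ≤ 1 ∧
      wordVal (fun x : X => (x : G)) W = wordVal (genOmVal X 𝓡) (V.take r) ∧
      variation (fun x : X => (x : G)) (edgeDist 𝓡 K p) (p.vertex (fun x : X => (x : G)) i)
        (wordFree W) = r := by
  rcases u with ⟨x, ε⟩ | ⟨l, h, hne⟩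
  · obtain rfl : V = [.gen (.inl x) ε] := hV
    obtain rfl : r = 0 := by simpa using hr
    exact ⟨[], by simp⟩
  · have hV' : IsLocalGeodesic 𝓡 K l h V := hV
    have hmem : wordVal (genOmVal X 𝓡) (V.take r) ∈ H l :=
      wordVal_mem_of_overLocal hK fun u hu => hV'.1.1 u (List.mem_of_mem_take hu)
    obtain ⟨W, hW, hWl, hWf⟩ := exists_short_word (S := X) l ⟨_, hmem⟩
    have hval : wordVal (fun x : X => (x : G)) W = wordVal (genOmVal X 𝓡) (V.take r) := by
      rw [← freeProj_wordFree, hWf]; simp [freeProj]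
    refine ⟨W, hW, hval, ?_⟩
    rw [variation_word_eq_of_inFactor _ _ _ hWl, hval,
      hp.edgeDist_eq (k := i) ⟨_, hu, rfl, by simpa using hmem⟩,
      hp.edgeDist_eq (k := i) ⟨_, hu, rfl, by simp⟩]
    rw [inv_mul_cancel_left, inv_mul_cancel, localLen_one, hV'.length_take]
    simp [hr.le]

/-- The lift of an 𝓗-edge is as long as the variation along that edge; an edge labelled by X has
length 1 and variation 0, and is absorbed by `j - i`. -/
lemma length_flatten_take_sub_le {p : CPath X H}
    (hp : p.HasSeparatedEdges (fun x : X => (x : G)))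
    {Vs : List (List (Letter (GenOm X 𝓡) (famK K)))}
    (hVs : List.Forall₂ (IsEdgeLift 𝓡 K) p.word Vs) {i j : ℕ} (hij : i ≤ j)
    (hj : j ≤ p.word.length) :
    ((Vs.take j).flatten.length : ℤ) - (Vs.take i).flatten.length ≤
      variation (fun x : X => (x : G)) (edgeDist 𝓡 K p) p.start (wordFree (p.word.take j)) -
      variation (fun x : X => (x : G)) (edgeDist 𝓡 K p) p.start (wordFree (p.word.take i)) +
      (j - i) := by
  induction j, hij using Nat.le_induction with
  | base => simp
  | succ j hij ih =>
    specialize ih (by omega)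
    have hjV : j < Vs.length := by rw [← hVs.length_eq]; omega
    have hlift : IsEdgeLift 𝓡 K p.word[j] Vs[j] := hVs.get hj hjV
    have e1 : (Vs.take (j + 1)).flatten.length = (Vs.take j).flatten.length + Vs[j].length := by
      rw [← List.take_concat_get' _ _ hjV]
      simp only [List.flatten_append, List.flatten_singleton, List.length_append]
    have e2 : wordFree (p.word.take (j + 1)) =
        wordFree (p.word.take j) * p.word[j].toFree := by
      rw [← List.take_concat_get' _ _ hj, wordFree_append, wordFree_cons, wordFree_nil, mul_one]
    have e3 : p.start * freeProj (fun x : X => (x : G)) H (wordFree (p.word.take j)) =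
        p.vertex (fun x : X => (x : G)) j := by
      rw [freeProj_wordFree]; rfl
    have key : (Vs[j].length : ℤ) ≤ variation (fun x : X => (x : G)) (edgeDist 𝓡 K p)
        (p.vertex (fun x : X => (x : G)) j) p.word[j].toFree + 1 := by
      have hget : p.word[j]? = some p.word[j] := List.getElem?_eq_getElem hj
      generalize p.word[j] = u at hlift hget
      rcases u with ⟨x, ε⟩ | ⟨l, h, hne⟩
      · have : Vs[j] = [.gen (.inl x) ε] := hlift
        rw [this, variation_gen]
        simp
      · have hV' : IsLocalGeodesic 𝓡 K l h Vs[j] := hlift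
        rw [variation_eq_of_inFactor _ _ _ (u := .per l h hne) rfl,
          hp.edgeDist_eq (k := j) ⟨_, hget, rfl, by simp [Letter.val]⟩,
          hp.edgeDist_eq (k := j) ⟨_, hget, rfl, by simp⟩,
          inv_mul_cancel_left, inv_mul_cancel, localLen_one]
        have := hV'.length_take Vs[j].length
        rw [List.take_length, hV'.1.2] at this
        change _ ≤ (localLen 𝓡 K l (h : G) : ℤ) - _ + _
        rw [this]
        simp
    rw [e1, e2, variation_mul, e3]
    push_cast
    linarith

/-- Otherwise the edges number `r` to `s`, at least two of them, could be replaced by at most one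
edge from the same K_{l,m}. -/
lemma IsLocalGeodesic.notMem_of_inFactor {l : Λ} {h : G}
    {V : List (Letter (GenOm X 𝓡) (famK K))} (hV : IsLocalGeodesic 𝓡 K l h V)
    {lm : Σ l, M l} {r s : ℕ} {u v : Letter (GenOm X 𝓡) (famK K)} (hrs : r < s)
    (hu : V[r]? = some u) (hul : u.InFactor lm) (hv : V[s]? = some v) (hvl : v.InFactor lm) :
    (wordVal (genOmVal X 𝓡) (V.take r))⁻¹ * wordVal (genOmVal X 𝓡) (V.take s) ∉ famK K lm := by
  intro hmem
  obtain ⟨hs, rfl⟩ := List.getElem?_eq_some_iff.mp hv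
  have hmem' := mul_mem hmem (hvl.val_mem (genOmVal X 𝓡))
  obtain ⟨W, hW, hWl, hWf⟩ := exists_short_word (S := GenOm X 𝓡) lm ⟨_, hmem'⟩
  have hlm : lm.1 = l := by
    have h1 := hV.1.1 u (List.mem_of_getElem? hu)
    rcases u with ⟨x, ε⟩ | ⟨lm', k, hne⟩
    · exact hul.elim
    · obtain rfl : lm' = lm := hul
      exact h1
  have hval : wordVal (genOmVal X 𝓡) W = (wordVal (genOmVal X 𝓡) (V.take r))⁻¹ *
      wordVal (genOmVal X 𝓡) (V.take s) * V[s].val (genOmVal X 𝓡) := by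
    rw [← freeProj_wordFree, hWf]; simp [freeProj]
  have := hV.2 (V.take r ++ W ++ V.drop (s + 1)) (fun w hw => by
    rw [List.mem_append, List.mem_append] at hw
    rcases hw with (hw | hw) | hw
    · exact hV.1.1 w (List.mem_of_mem_take hw)
    · exact hlm ▸ (hWl w hw).overLocal
    · exact hV.1.1 w (List.mem_of_mem_drop hw)) (by
      rw [wordVal_append, wordVal_append, hval, ← hV.1.2]
      conv_rhs => rw [← List.take_append_drop s V, List.drop_eq_getElem_cons hs]
      rw [wordVal_append, wordVal_cons]
      group)
  simp only [List.length_append, List.length_take, List.length_drop] at this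
  omega

end Lifts

/-! ### Whole lifts: separation of edges and the distance estimate -/

section LiftPaths

variable {G Λ : Type*} [Group G] {X : Set G} {H : Λ → Subgroup G} {𝓡 : Set (List (Letter X H))}
  {M : Λ → Type*} {K : ∀ l, M l → Subgroup G}

lemma IsMinimalLift.exists_position {p : CPath X H} {q : CPath (GenOm X 𝓡) (famK K)}
    {Vs : List (List (Letter (GenOm X 𝓡) (famK K)))} (hstart : q.start = p.start)
    (hVs : List.Forall₂ (IsEdgeLift 𝓡 K) p.word Vs) (hq : q.word = Vs.flatten) {n : ℕ}
    (hn : n < q.word.length) :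
    ∃ (i : ℕ) (u : Letter X H) (V : List (Letter (GenOm X 𝓡) (famK K))) (r : ℕ),
      p.word[i]? = some u ∧ Vs[i]? = some V ∧ IsEdgeLift 𝓡 K u V ∧ r < V.length ∧
      q.word[n]? = V[r]? ∧ n = (Vs.take i).flatten.length + r ∧
      q.vertex (genOmVal X 𝓡) n =
        p.vertex (fun x : X => (x : G)) i * wordVal (genOmVal X 𝓡) (V.take r) := by
  rw [hq] at hn
  obtain ⟨i, hi, r, hr, h1, h2, h3⟩ := exists_position_flatten Vs hn
  have hip : i < p.word.length := by rw [hVs.length_eq]; exact hi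
  refine ⟨i, p.word[i], Vs[i], r, List.getElem?_eq_getElem hip, List.getElem?_eq_getElem hi,
    hVs.get hip hi, hr, by rw [hq]; exact h2, h3, ?_⟩
  rw [CPath.vertex, CPath.vertex, hq, h1, wordVal_append, hstart,
    wordVal_flatten_of_forall₂ (List.forall₂_take i hVs), mul_assoc]

lemma position_le {Vs : List (List (Letter (GenOm X 𝓡) (famK K)))} {i j r s : ℕ}
    {V : List (Letter (GenOm X 𝓡) (famK K))} (hV : Vs[j]? = some V) (hs : s < V.length)
    (h : (Vs.take i).flatten.length + r ≤ (Vs.take j).flatten.length + s) : i ≤ j := by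
  by_contra hlt
  obtain ⟨hj, rfl⟩ := List.getElem?_eq_some_iff.mp hV
  have h1 := length_flatten_take_mono Vs (show j + 1 ≤ i by omega)
  rw [← List.take_concat_get' _ _ hj] at h1
  simp only [List.flatten_append, List.flatten_singleton, List.length_append] at h1
  omega

lemma IsEdgeLift.inFactor {u : Letter X H} {V : List (Letter (GenOm X 𝓡) (famK K))}
    (h : IsEdgeLift 𝓡 K u V) {lm : Σ l, M l} {v : Letter (GenOm X 𝓡) (famK K)} (hv : v ∈ V)
    (hvl : v.InFactor lm) : u.InFactor lm.1 ∧ ∃ k, IsLocalGeodesic 𝓡 K lm.1 k V := by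
  rcases u with ⟨x, ε⟩ | ⟨l, k, hne⟩
  · obtain rfl : V = [.gen (.inl x) ε] := h
    rw [List.mem_singleton.mp hv] at hvl
    exact hvl.elim
  · have hV : IsLocalGeodesic 𝓡 K l k V := h
    have h1 := hV.1.1 v hv
    rcases v with ⟨x, ε⟩ | ⟨lm', k', hne'⟩
    · exact hvl.elim
    · obtain rfl : lm' = lm := hvl
      obtain rfl : lm'.1 = l := h1
      exact ⟨rfl, k, hV⟩

/-- Two edges in one coset of K_{l,m} lie over edges of p in one coset of H_l. By separation in p
these coincide, and then the geodesic over this edge could be shortened. -/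
lemma IsMinimalLift.hasSeparatedEdges {p : CPath X H} {q : CPath (GenOm X 𝓡) (famK K)}
    (hq : IsMinimalLift 𝓡 K p q) (hK : ∀ l m, K l m ≤ H l)
    (hp : p.HasSeparatedEdges (fun x : X => (x : G))) :
    q.HasSeparatedEdges (genOmVal X 𝓡) := by
  obtain ⟨hstart, Vs, hVs, hword⟩ := hq
  intro lm m n u v hmn hu hul hv hvl hmem
  obtain ⟨i, x, V, r, hx, hV, hlift, hr, hm, hmi, hmv⟩ :=
    IsMinimalLift.exists_position hstart hVs hword (List.getElem?_eq_some_iff.mp hu).1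
  obtain ⟨j, y, W, s, hy, hW, hlift', hs, hn, hnj, hnv⟩ :=
    IsMinimalLift.exists_position hstart hVs hword (List.getElem?_eq_some_iff.mp hv).1
  rw [hu] at hm
  rw [hv] at hn
  obtain ⟨hxl, k, hgeo⟩ := hlift.inFactor (List.mem_of_getElem? hm.symm) hul
  obtain ⟨hyl, k', hgeo'⟩ := hlift'.inFactor (List.mem_of_getElem? hn.symm) hvl
  rw [hmv, hnv] at hmem
  have hij : i ≤ j := position_le hW hs (by omega : _ + r ≤ _)
  rcases hij.lt_or_eq with hlt | rfl
  · refine hp lm.1 i j x y hlt hx hxl hy hyl ?_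
    have h1 : wordVal (genOmVal X 𝓡) (V.take r) ∈ H lm.1 :=
      wordVal_mem_of_overLocal hK fun u hu => hgeo.1.1 u (List.mem_of_mem_take hu)
    have h2 : wordVal (genOmVal X 𝓡) (W.take s) ∈ H lm.1 :=
      wordVal_mem_of_overLocal hK fun u hu => hgeo'.1.1 u (List.mem_of_mem_take hu)
    have := mul_mem (mul_mem h1 (hK lm.1 lm.2 hmem)) (inv_mem h2)
    convert this using 1
    group
  · obtain rfl := Option.some.inj (hV.symm.trans hW)
    refine hgeo.notMem_of_inFactor (r := r) (s := s) (by omega) hm.symm hul hn.symm hvl ?_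
    convert hmem using 1
    group

/-- The linear lower bound for distances in the Cayley graph of `X ⊔ Ω ⊔ 𝓚` of the vertices of a
minimal lift. -/
lemma IsMinimalLift.sub_le {p : CPath X H} {q : CPath (GenOm X 𝓡) (famK K)}
    (hq : IsMinimalLift 𝓡 K p q) (hK : ∀ l m, K l m ≤ H l)
    (hp : p.HasSeparatedEdges (fun x : X => (x : G)))
    (hgen : IsRelGenerating (genOmVal X 𝓡) (famK K))
    (hex : ∀ l, ∀ h ∈ H l, ∃ V : List (Letter (GenOm X 𝓡) (famK K)),
      (∀ u ∈ V, OverLocal l u) ∧ wordVal (genOmVal X 𝓡) V = h) {A : ℕ}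
    (hA : ∀ W : List (Letter X H), wordVal (fun x : X => (x : G)) W = 1 →
      LoopBound (fun x : X => (x : G)) 𝓡 (wordFree W) (A * W.length))
    {m n : ℕ} (hmn : m ≤ n) (hn : n < q.word.length) :
    ∃ i j : ℕ, i ≤ j ∧ i < p.word.length ∧ j < p.word.length ∧
      vdist (fun x : X => (x : G)) H (p.vertex (fun x : X => (x : G)) i)
        (p.vertex (fun x : X => (x : G)) j) ≤
        vdist (genOmVal X 𝓡) (famK K) (q.vertex (genOmVal X 𝓡) m) (q.vertex (genOmVal X 𝓡) n) + 2 ∧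
      n - m ≤ (j - i) + vdist (genOmVal X 𝓡) (famK K) (q.vertex (genOmVal X 𝓡) m)
          (q.vertex (genOmVal X 𝓡) n) +
        A * ((j - i) + vdist (genOmVal X 𝓡) (famK K) (q.vertex (genOmVal X 𝓡) m)
          (q.vertex (genOmVal X 𝓡) n) + 2) := by
  obtain ⟨hstart, Vs, hVs, hword⟩ := hq
  obtain ⟨i, x, V, r, hx, hV, hlift, hr, -, hmi, hmv⟩ :=
    IsMinimalLift.exists_position hstart hVs hword (hmn.trans_lt hn)
  obtain ⟨j, y, W, s, hy, hW, hlift', hs, -, hnj, hnv⟩ :=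
    IsMinimalLift.exists_position hstart hVs hword hn
  have hij : i ≤ j := position_le hW hs (by omega : _ + r ≤ _)
  have hi : i < p.word.length := (List.getElem?_eq_some_iff.mp hx).1
  have hj : j < p.word.length := (List.getElem?_eq_some_iff.mp hy).1
  obtain ⟨U, hU, hUv⟩ := exists_word_vdist hgen (q.vertex (genOmVal X 𝓡) m)
    (q.vertex (genOmVal X 𝓡) n)
  obtain ⟨P, hP, hPv, hPφ⟩ := exists_short_word_block hK hp hx hlift hr
  obtain ⟨Q, hQ, hQv, hQφ⟩ := exists_short_word_block hK hp hy hlift' hs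
  rw [← hU]
  rw [← hPv] at hmv
  rw [← hQv] at hnv
  obtain ⟨T, hT, hTf, hTv⟩ := p.exists_word_between (a := fun x : X => (x : G)) hij
  have hlen := length_flatten_take_sub_le hp hVs hij hj.le
  have hUv' : q.vertex (genOmVal X 𝓡) m * wordVal (fun x : X => (x : G))
      (U.map (Letter.proj hK)) = q.vertex (genOmVal X 𝓡) n := by rw [wordVal_map_proj, hUv]
  refine ⟨i, j, hij, hi, hj, ?_, ?_⟩
  · refine (vdist_le _ (P ++ U.map (Letter.proj hK) ++ wordInv Q) ?_).trans ?_
    · rw [wordVal_append, wordVal_append, wordVal_wordInv, ← mul_assoc, ← mul_assoc, ← hmv, hUv',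
        hnv, mul_inv_cancel_right]
    · simp only [List.length_append, List.length_map, length_wordInv]
      omega
  · set φ := edgeDist 𝓡 K p
    have hφ : LocalLipschitz 𝓡 K φ 1 := hp.localLipschitz_edgeDist hK hex
    have hTφ := congrArg (variation (fun x : X => (x : G)) φ p.start) hTf
    rw [wordFree_append, variation_mul, freeProj_wordFree] at hTφ
    change _ + variation _ φ (p.vertex (fun x : X => (x : G)) i) _ = _ at hTφ
    -- The loop based at vertex `m` of q: down to p by P⁻¹, along p by T, up to vertex `n` of q by
    -- Q, and back by U⁻¹.
    have hloop := (hA (wordInv P ++ T ++ Q ++ wordInv (U.map (Letter.proj hK))) (by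
      have h1 : p.vertex (fun x : X => (x : G)) j * wordVal (fun x : X => (x : G)) Q =
          p.vertex (fun x : X => (x : G)) i * wordVal (fun x : X => (x : G)) P *
            wordVal (fun x : X => (x : G)) (U.map (Letter.proj hK)) := by
        rw [← hnv, ← hmv, hUv']
      rw [← hTv, mul_assoc, mul_assoc, mul_left_cancel_iff] at h1
      simp only [wordVal_append, wordVal_wordInv, mul_assoc]
      rw [← mul_assoc _ _ (wordVal _ _)⁻¹, h1]
      group)).2 φ 1 hφ.omLipschitz (q.vertex (genOmVal X 𝓡) m)
    have hUφ := hφ.abs_variation_le hK U (q.vertex (genOmVal X 𝓡) m)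
    have e1 : variation (fun x : X => (x : G)) φ (q.vertex (genOmVal X 𝓡) m)
        (wordFree (wordInv P ++ T ++ Q ++ wordInv (U.map (Letter.proj hK)))) =
        -(r : ℤ) + variation (fun x : X => (x : G)) φ (p.vertex (fun x : X => (x : G)) i)
          (wordFree T) + s -
        variation (fun x : X => (x : G)) φ (q.vertex (genOmVal X 𝓡) m)
          (wordFree (U.map (Letter.proj hK))) := by
      have g1 : q.vertex (genOmVal X 𝓡) m * (wordVal (fun x : X => (x : G)) P)⁻¹ =
          p.vertex (fun x : X => (x : G)) i := by rw [hmv, mul_inv_cancel_right]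
      have g2 : q.vertex (genOmVal X 𝓡) n * (wordVal (fun x : X => (x : G))
          (U.map (Letter.proj hK)))⁻¹ = q.vertex (genOmVal X 𝓡) m := by
        rw [← hUv', mul_inv_cancel_right]
      simp only [wordFree_append, wordFree_wordInv, variation_mul, variation_inv, map_mul, map_inv,
        freeProj_wordFree, ← mul_assoc, g1, hTv, hPφ, hQφ, ← hnv, g2]
      ring
    rw [e1] at hloop
    simp only [List.length_append, List.length_map, length_wordInv, one_mul] at hloop hUφ
    -- P and Q have length at most 1 each, whence the 2.
    have hbd : ((A * (P.length + T.length + Q.length + U.length) : ℕ) : ℤ) ≤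
        ((A * ((j - i) + U.length + 2) : ℕ) : ℤ) := by
      refine Int.ofNat_le.mpr (Nat.mul_le_mul_left _ ?_)
      omega
    have h3 := (abs_le.mp (hloop.trans hbd)).2
    have h4 := (abs_le.mp hUφ).2
    generalize A * ((j - i) + U.length + 2) = B at h3 ⊢
    omega

end LiftPaths

end RelHyp

theorem mainTheorem5 {G Λ : Type*} [Group G] {M : Λ → Type*}
    (H : Λ → Subgroup G) (K : ∀ l, M l → Subgroup G) (hK : ∀ l m, K l m ≤ H l)
    (X : Set G) (𝓡 : Set (List (RelHyp.Letter X H)))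
    (hpres : RelHyp.IsFiniteRelPresentation X H 𝓡)
    (hhyp : RelHyp.IsRelHyperbolic H)
    (hgen : RelHyp.IsRelGenerating (fun x : X => (x : G)) (RelHyp.famK K))
    (α β : ℝ) (hα : 1 ≤ α) (hβ : 0 ≤ β) :
    ∃ C D : ℝ, 1 ≤ C ∧ 0 ≤ D ∧
      ∀ p : RelHyp.CPath X H,
        p.IsLocallyMinimal → p.WithoutBacktracking (fun x : X => (x : G)) →
        p.IsQuasigeodesic (fun x : X => (x : G)) α β →
        (∃ q, RelHyp.IsMinimalLift 𝓡 K p q) ∧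
        ∀ q, RelHyp.IsMinimalLift 𝓡 K p q →
          q.IsLocallyMinimal ∧ q.WithoutBacktracking (RelHyp.genOmVal X 𝓡) ∧
          q.IsQuasigeodesic (RelHyp.genOmVal X 𝓡) C D := by
  obtain ⟨A, hA⟩ := RelHyp.exists_linear_loopBound hpres hhyp
  have hex : ∀ l, ∀ h ∈ H l, ∃ V : List (RelHyp.Letter (RelHyp.GenOm X 𝓡) (RelHyp.famK K)),
      (∀ u ∈ V, RelHyp.OverLocal l u) ∧ RelHyp.wordVal (RelHyp.genOmVal X 𝓡) V = h :=
    fun l h hh => RelHyp.exists_local_word hK hpres hgen hh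
  have hgen' := RelHyp.isRelGenerating_genOm 𝓡 hgen
  have hA0 : (0 : ℝ) ≤ A := Nat.cast_nonneg A
  have hC : (1 : ℝ) ≤ (A + 1) * (α + 1) := by nlinarith
  have hD : (0 : ℝ) ≤ (A + 1) * (α * (2 + β)) + 2 * A := by positivity
  -- With v the distance in Γ(G, X ⊔ Ω ⊔ 𝓚), insert j - i ≤ α (v + 2 + β) into n - m ≤ (A + 1)(j -
  -- i) + (A + 1) v + 2A; the final 3 is the cost of passing from vertices to arbitrary points.
  refine ⟨(A + 1) * (α + 1), (A + 1) * (α * (2 + β)) + 2 * A + 3, hC, by linarith,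
    fun p hmin hback hquasi => ⟨RelHyp.exists_isMinimalLift hex p, fun q hq => ?_⟩⟩
  have hp := RelHyp.CPath.hasSeparatedEdges hmin hback
  have hsep := hq.hasSeparatedEdges hK hp
  refine ⟨hsep.isLocallyMinimal, hsep.withoutBacktracking,
    RelHyp.CPath.isQuasigeodesic_of_sub_le hgen' hC hD fun m n hmn hn => ?_⟩
  obtain ⟨i, j, hij, hi, hj, hd, hlen⟩ := hq.sub_le hK hp hgen' hex hA hmn hn
  have hpq := hquasi.sub_le hα hi hj
  generalize RelHyp.vdist (RelHyp.genOmVal X 𝓡) (RelHyp.famK K) _ _ = v at *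
  have hd' : (RelHyp.vdist (fun x : X => (x : G)) H (p.vertex (fun x : X => (x : G)) i)
      (p.vertex (fun x : X => (x : G)) j) : ℝ) ≤ v + 2 := by exact_mod_cast hd
  have hlen' : (n : ℝ) - m ≤ (j - i) + v + A * ((j - i) + v + 2) := by
    have := (Nat.cast_le (α := ℝ)).mpr hlen
    push_cast [Nat.cast_sub hmn, Nat.cast_sub hij] at this
    exact this
  have hji : (j : ℝ) - i ≤ α * (v + 2 + β) := hpq.trans (by gcongr)
  calc (n : ℝ) - m ≤ (A + 1) * (j - i) + (A + 1) * v + 2 * A := by linarith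
    _ ≤ (A + 1) * (α * (v + 2 + β)) + (A + 1) * v + 2 * A := by gcongr
    _ = _ := by ring
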